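/- Let $L\ge 1$, $p\in(0,1)$, and let $\alpha\in M_L(\mathbb C)$ have spectral norm $<1$; put $\rho=(1-\alpha\alpha^*)^{1/2}$, $\tilde\rho=(1-\alpha^*\alpha)^{1/2}$. Let $(\widetilde V^{(n)},d^{(n)},\theta^{(n)},\widetilde U^{(n)},D^{(n)},\Theta^{(n)})_{n\in\mathbb Z}$ be independent and identically distributed in $n$, with six independent components: $\widetilde V^{(n)},\widetilde U^{(n)}$ are Haar distributed on the unitary group $U(L)$; $d^{(n)},D^{(n)}\in\{-1,1\}^L$ have independent entries equal to $1$ with probability $p$ and to $-1$ with probability $1-p$; $\theta^{(n)},\Theta^{(n)}\in[0,2\pi]^L$ have independent uniformly distributed entries (tuples are identified with diagonal matrices). Set $$U^{(n)}_\omega=e^{i\Theta^{(n)}}\widetilde U^{(n)}D^{(n)}(\widetilde U^{(n)})^*,\qquad V^{(n)}_\omega=\widetilde V^{(n)}d^{(n)}(\widetilde V^{(n)})^*e^{i\theta^{(n)}},\qquad S^{(n)}_\omega=\begin{pmatrix}\alpha&\rho\,U^{(n)}_\omega\\ V^{(n)}_\omega\tilde\rho&-V^{(n)}_\omega\alpha^*U^{(n)}_\omega\end{pmatrix}.$$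 For $a<b$ in $\mathbb Z\cup\{\pm\infty\}$ and $B_-,B_+\in U(L)$, let $\mathbb U^{[a,b]}_\omega=\mathbb V^{[a,b]}_\omega\mathbb W^{[a,b]}_\omega$ on $\ell^2([a,b]\cap\mathbb Z,\mathbb C^L)$, where $\mathbb V^{[a,b]}_\omega$ (resp. $\mathbb W^{[a,b]}_\omega$) is the direct sum of the matrices $S^{(n)}_\omega$ with $n$ even (resp. odd), acting on the pair of sites $(n,n+1)$, over all such pairs contained in $[a,b]$, completed by $B_-$ at the site $a$ if its pair is $\{a-1,a\}$ and by $B_+$ at the site $b$ if its pair is $\{b,b+1\}$. (So each finite endpoint carries exactly one boundary condition, and for $a=-\infty$, $b=+\infty$ there is none.) Let $\|\cdot\|$ be a norm on $M_L(\mathbb C)$ subordinate to some norm on $\mathbb C^L$. Then for every $s\in(0,\tfrac14)$ there is $C(s)>0$, which may depend also on $L,p,\alpha$ and $\|\cdot\|$, such that for all $B_-,B_+\in U(L)$, every $z\in\mathbb C$ with $|z|\ne1$, and all $a<b$ in $\mathbb Z\cup\{\pm\infty\}$, the operator $\mathbb U^{[a,b]}_\omega-z$ is invertible for every $\omega$,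 and for all integers $k,l\in[a,b]$ with $|k-l|>4$ the $L\times L$ block $G^{[a,b]}_\omega(z,k,l)$ of $(\mathbb U^{[a,b]}_\omega-z)^{-1}$ in row $k$ and column $l$ satisfies $$\mathbb E\big(\|G^{[a,b]}_\omega(z,k,l)\|^s\big)\le C(s).$$ -/

import Mathlib

open MeasureTheory

namespace ScatteringZipper

/-! ### The probability space -/

/-- The unitary group `U(L)`. -/
abbrev UL (L : ℕ) : Type := Matrix.unitaryGroup (Fin L) ℂ

noncomputable instance instMeasurableSpaceUL (L : ℕ) : MeasurableSpace (UL L) := borel _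

instance instBorelSpaceUL (L : ℕ) : BorelSpace (UL L) := ⟨rfl⟩

instance instCompactSpaceUL (L : ℕ) : CompactSpace (UL L) := by
  have hK : IsCompact (Set.univ.pi fun _ : Fin L => Set.univ.pi fun _ : Fin L =>
      Metric.closedBall (0 : ℂ) 1) :=
    isCompact_univ_pi fun _ => isCompact_univ_pi fun _ => isCompact_closedBall _ _
  have hclosed : IsClosed ((Matrix.unitaryGroup (Fin L) ℂ : Set (Matrix (Fin L) (Fin L) ℂ))) := by
    have h : ((Matrix.unitaryGroup (Fin L) ℂ : Set (Matrix (Fin L) (Fin L) ℂ)))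
        = {A | A * star A = 1} := by
      ext A
      exact Matrix.mem_unitaryGroup_iff
    rw [h]
    exact isClosed_eq (by fun_prop) continuous_const
  refine isCompact_iff_compactSpace.mp (hK.of_isClosed_subset hclosed ?_)
  intro A hA i _ j _
  simpa using entry_norm_bound_of_unitary hA i j

/-- One half of the randomness attached to a site: an element of
`U(L) × {-1,1}^L × [0,2π]^L`. -/
abbrev HalfSample (L : ℕ) : Type :=
  UL L × (Fin L → ℤˣ) × (Fin L → Set.Icc (0 : ℝ) (2 * Real.pi))

/-- The randomness `ω_n = (Ṽ, d, θ, Ũ, D, Θ)` attached to a site; the first half is `(Ṽ, d, θ)`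
and the second half is `(Ũ, D, Θ)`. -/
abbrev SiteSample (L : ℕ) : Type := HalfSample L × HalfSample L

/-- The sample space `Ω`. -/
abbrev Sample (L : ℕ) : Type := ℤ → SiteSample L

/-- The Haar probability measure on `U(L)`. -/
noncomputable def haarU (L : ℕ) : Measure (UL L) := Measure.haarMeasure ⊤

/-- The Bernoulli law of parameter `p` on `{-1,1}`. -/
noncomputable def bernoulliSign (p : ℝ) : Measure ℤˣ :=
  ENNReal.ofReal p • Measure.dirac 1 + ENNReal.ofReal (1 - p) • Measure.dirac (-1)

/-- The uniform law on `[0,2π]`. -/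
noncomputable def uniformAngle : Measure (Set.Icc (0 : ℝ) (2 * Real.pi)) :=
  (ENNReal.ofReal (2 * Real.pi))⁻¹ • Measure.comap Subtype.val volume

noncomputable def halfLaw (L : ℕ) (p : ℝ) : Measure (HalfSample L) :=
  (haarU L).prod
    ((Measure.pi fun _ : Fin L => bernoulliSign p).prod (Measure.pi fun _ : Fin L => uniformAngle))

noncomputable def siteLaw (L : ℕ) (p : ℝ) : Measure (SiteSample L) :=
  (halfLaw L p).prod (halfLaw L p)

/-- The law `ℙ` on `Ω`: the sites are independent and identically distributed. -/
noncomputable def law (L : ℕ) (p : ℝ) : Measure (Sample L) :=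
  Measure.infinitePi fun _ : ℤ => siteLaw L p

instance isProbabilityMeasure_haarU (L : ℕ) : IsProbabilityMeasure (haarU L) :=
  ⟨Measure.haarMeasure_self⟩

theorem isProbabilityMeasure_bernoulliSign {p : ℝ} (h0 : 0 ≤ p) (h1 : p ≤ 1) :
    IsProbabilityMeasure (bernoulliSign p) :=
  ⟨by simp [bernoulliSign, ← ENNReal.ofReal_add h0 (sub_nonneg.2 h1)]⟩

instance isProbabilityMeasure_uniformAngle : IsProbabilityMeasure uniformAngle :=
  ⟨by
    have h : (Measure.comap Subtype.val volume : Measure (Set.Icc (0 : ℝ) (2 * Real.pi))) Set.univ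
        = ENNReal.ofReal (2 * Real.pi) := by
      rw [comap_subtype_coe_apply measurableSet_Icc, Set.image_univ, Subtype.range_coe,
        Real.volume_Icc, sub_zero]
    rw [uniformAngle, Measure.smul_apply, h, smul_eq_mul]
    exact ENNReal.inv_mul_cancel (by simp [Real.pi_pos]) ENNReal.ofReal_ne_top⟩

/-- `ℙ` is a probability measure: in particular `law` is the genuine infinite product. -/
theorem isProbabilityMeasure_law (L : ℕ) {p : ℝ} (h0 : 0 ≤ p) (h1 : p ≤ 1) :
    IsProbabilityMeasure (law L p) := by
  have := isProbabilityMeasure_bernoulliSign h0 h1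
  have : IsProbabilityMeasure (halfLaw L p) := by unfold halfLaw; infer_instance
  have : IsProbabilityMeasure (siteLaw L p) := by unfold siteLaw; infer_instance
  unfold law
  infer_instance

/-! ### The random phases and the scattering matrices -/

/-- A diagonal matrix with unimodular entries, as an element of `U(L)`. -/
def diagU {L : ℕ} (c : Fin L → ℂ) (hc : ∀ i, ‖c i‖ = 1) : UL L :=
  ⟨Matrix.diagonal c, by
    rw [Matrix.mem_unitaryGroup_iff, Matrix.star_eq_conjTranspose, Matrix.diagonal_conjTranspose,
      Matrix.diagonal_mul_diagonal, ← Matrix.diagonal_one]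
    congr 1
    funext i
    simp [Complex.mul_conj, Complex.normSq_eq_norm_sq, hc i]⟩

/-- The diagonal matrix of a tuple of signs. -/
def signU {L : ℕ} (d : Fin L → ℤˣ) : UL L :=
  diagU (fun i => ((d i : ℤ) : ℂ)) fun i => by
    rcases Int.units_eq_one_or (d i) with h | h <;> simp [h]

/-- The diagonal matrix `e^{iθ}` of a tuple of angles. -/
noncomputable def phaseU {L : ℕ} (θ : Fin L → Set.Icc (0 : ℝ) (2 * Real.pi)) : UL L :=
  diagU (fun i => Complex.exp (((θ i : ℝ) : ℂ) * Complex.I)) fun _ =>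
    Complex.norm_exp_ofReal_mul_I _

/-- `U^{(n)}_ω = e^{iΘ} Ũ D Ũ^*`. -/
noncomputable def Uph {L : ℕ} (ω : Sample L) (n : ℤ) : UL L :=
  phaseU (ω n).2.2.2 * (ω n).2.1 * signU (ω n).2.2.1 * (ω n).2.1⁻¹

/-- `V^{(n)}_ω = Ṽ d Ṽ^* e^{iθ}`. -/
noncomputable def Vph {L : ℕ} (ω : Sample L) (n : ℤ) : UL L :=
  (ω n).1.1 * signU (ω n).1.2.1 * (ω n).1.1⁻¹ * phaseU (ω n).1.2.2

/-- The fibre `ℂ^L`, with its Hermitian norm. -/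
abbrev Fib (L : ℕ) : Type := EuclideanSpace ℂ (Fin L)

/-- The operator on `ℂ^L` given by a matrix. -/
noncomputable abbrev op {L : ℕ} (A : Matrix (Fin L) (Fin L) ℂ) : Fib L →L[ℂ] Fib L :=
  Matrix.toEuclideanCLM (n := Fin L) (𝕜 := ℂ) A

open scoped MatrixOrder in
/-- `ρ(α) = (1 - α α^*)^{1/2}`. -/
noncomputable def rho {L : ℕ} (α : Matrix (Fin L) (Fin L) ℂ) : Matrix (Fin L) (Fin L) ℂ :=
  CFC.sqrt (1 - α * α.conjTranspose)

open scoped MatrixOrder in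
/-- `ρ̃(α) = (1 - α^* α)^{1/2}`. -/
noncomputable def rhoT {L : ℕ} (α : Matrix (Fin L) (Fin L) ℂ) : Matrix (Fin L) (Fin L) ℂ :=
  CFC.sqrt (1 - α.conjTranspose * α)

/-- The upper right block of `S^{(n)}_ω`. -/
noncomputable def blockB {L : ℕ} (α : Matrix (Fin L) (Fin L) ℂ) (ω : Sample L) (n : ℤ) :
    Matrix (Fin L) (Fin L) ℂ :=
  rho α * (Uph ω n : Matrix (Fin L) (Fin L) ℂ)

/-- The lower left block of `S^{(n)}_ω`. -/
noncomputable def blockC {L : ℕ} (α : Matrix (Fin L) (Fin L) ℂ) (ω : Sample L) (n : ℤ) :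
    Matrix (Fin L) (Fin L) ℂ :=
  (Vph ω n : Matrix (Fin L) (Fin L) ℂ) * rhoT α

/-- The lower right block of `S^{(n)}_ω`. -/
noncomputable def blockD {L : ℕ} (α : Matrix (Fin L) (Fin L) ℂ) (ω : Sample L) (n : ℤ) :
    Matrix (Fin L) (Fin L) ℂ :=
  -((Vph ω n : Matrix (Fin L) (Fin L) ℂ) * α.conjTranspose * (Uph ω n : Matrix (Fin L) (Fin L) ℂ))

/-! ### Operators on `ℓ²(I, ℂ^L)` -/

/-- The Hilbert space `ℓ²(I, ℂ^L)`. -/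
abbrev Hil (L : ℕ) (I : Set ℤ) : Type := lp (fun _ : I => Fib L) 2

/-- The block-diagonal operator `(f_i) ↦ (A_i f_i)`. -/
noncomputable def diagOp {L : ℕ} {I : Set ℤ} (A : I → Fib L →L[ℂ] Fib L)
    (hA : ∃ C, ∀ i, ‖A i‖ ≤ C) : Hil L I →L[ℂ] Hil L I :=
  have key : ∃ C : ℝ, 0 ≤ C ∧ ∀ (f : Hil L I) (i : I), ‖A i (f i)‖ ≤ C * ‖f i‖ := by
    obtain ⟨C, hC⟩ := hA
    refine ⟨max C 0, le_max_right _ _, fun f i => ?_⟩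
    exact (A i).le_of_opNorm_le ((hC i).trans (le_max_left _ _)) _
  have mem : ∀ f : Hil L I, Memℓp (fun i => A i (f i)) 2 := by
    obtain ⟨C, hC, h⟩ := key
    intro f
    refine Memℓp.mono' ((lp.memℓp f).const_smul (C : ℂ)) fun i => ?_
    simpa [norm_smul, abs_of_nonneg hC] using h f i
  LinearMap.mkContinuousOfExistsBound
    { toFun := fun f => (⟨fun i => A i (f i), mem f⟩ : Hil L I)
      map_add' := fun f g => by ext1; funext i; exact map_add (A i) _ _
      map_smul' := fun c f => by ext1; funext i; exact map_smul (A i) _ _ }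
    (by
      obtain ⟨C, hC, h⟩ := key
      refine ⟨C, fun f => ?_⟩
      have h2 : ‖(C : ℂ) • f‖ = C * ‖f‖ := by
        rw [norm_smul, Complex.norm_real, Real.norm_of_nonneg hC]
      rw [← h2]
      refine lp.norm_mono (by norm_num) fun i => ?_
      have h3 : ‖((C : ℂ) • f : Hil L I) i‖ = C * ‖f i‖ := by
        rw [lp.coeFn_smul, Pi.smul_apply, norm_smul, Complex.norm_real, Real.norm_of_nonneg hC]
      rw [h3]
      exact h f i)

/-- The operator `(f_i) ↦ (f_{σ(i)})` for an injective map `σ`. -/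
noncomputable def reindexOp {L : ℕ} {I : Set ℤ} (σ : I → I) (hσ : Function.Injective σ) :
    Hil L I →L[ℂ] Hil L I :=
  have mem : ∀ f : Hil L I, Memℓp (fun i => f (σ i)) 2 := fun f =>
    memℓp_gen (((lp.memℓp f).summable (by norm_num)).comp_injective hσ)
  LinearMap.mkContinuous
    { toFun := fun f => (⟨fun i => f (σ i), mem f⟩ : Hil L I)
      map_add' := fun f g => rfl
      map_smul' := fun c f => rfl } 1
    (by
      intro f
      rw [one_mul]
      refine lp.norm_le_of_tsum_le (by norm_num) (norm_nonneg f) ?_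
      rw [lp.norm_rpow_eq_tsum (by norm_num) f]
      exact tsum_comp_le_tsum_of_inj ((lp.memℓp f).summable (by norm_num))
        (fun i => by positivity) hσ)

/-! ### The scattering zipper restricted to an interval -/

/-- The integers in the interval `[a,b]`, with `a, b ∈ ℤ ∪ {±∞}`. -/
def sites (a b : WithBot (WithTop ℤ)) : Set ℤ :=
  {n | a ≤ ((n : WithTop ℤ) : WithBot (WithTop ℤ)) ∧ ((n : WithTop ℤ) : WithBot (WithTop ℤ)) ≤ b}

/-- `ℤ` is cut into the pairs `{n, n+1}` with `n ≡ r` modulo `2`; `mate r i` is the other element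
of the pair of `i`. -/
def mate (r i : ℤ) : ℤ := if Even (i - r) then i + 1 else i - 1

open Classical in
/-- The mate of a site if it lies in `I`, otherwise the site itself. -/
noncomputable def mateIn (r : ℤ) {I : Set ℤ} (i : I) : I :=
  if h : mate r i ∈ I then ⟨mate r i, h⟩ else i

theorem mate_mate (r i : ℤ) : mate r (mate r i) = i := by
  unfold mate
  split_ifs with h1 h2 h2 <;> grind

theorem mateIn_injective (r : ℤ) (I : Set ℤ) : Function.Injective (mateIn r (I := I)) := by
  have h : Function.Involutive (mateIn r (I := I)) := by
    intro i
    apply Subtype.ext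
    by_cases hi : mate r i ∈ I
    · simp [mateIn, hi, mate_mate]
    · simp [mateIn, hi]
  exact h.injective

open Classical in
/-- The diagonal `L × L` blocks of the layer of parity `r`. A site `i` whose mate lies outside `I`
carries a boundary condition: `bl` if the mate is `i - 1`, `br` if it is `i + 1`. -/
noncomputable def layerDiag {L : ℕ} (α : Matrix (Fin L) (Fin L) ℂ) (bl br : UL L) (ω : Sample L)
    (r : ℤ) {I : Set ℤ} (i : I) : Matrix (Fin L) (Fin L) ℂ :=
  if mate r i ∈ I then
    if Even ((i : ℤ) - r) then α else blockD α ω (i - 1)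
  else
    if Even ((i : ℤ) - r) then (br : Matrix (Fin L) (Fin L) ℂ) else (bl : Matrix (Fin L) (Fin L) ℂ)

open Classical in
/-- The off-diagonal `L × L` blocks, in row `i` and column `mate r i`, of the layer of
parity `r`. -/
noncomputable def layerOff {L : ℕ} (α : Matrix (Fin L) (Fin L) ℂ) (ω : Sample L)
    (r : ℤ) {I : Set ℤ} (i : I) : Matrix (Fin L) (Fin L) ℂ :=
  if mate r i ∈ I then
    if Even ((i : ℤ) - r) then blockB α ω i else blockC α ω (i - 1)
  else 0

theorem norm_op_mul_unitary {L : ℕ} (A : Matrix (Fin L) (Fin L) ℂ) (u : UL L) :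
    ‖op (A * (u : Matrix (Fin L) (Fin L) ℂ))‖ = ‖op A‖ := by
  have hu : op (u : Matrix (Fin L) (Fin L) ℂ) ∈ unitary (Fib L →L[ℂ] Fib L) :=
    Unitary.map_mem (Matrix.toEuclideanCLM (n := Fin L) (𝕜 := ℂ)) u.2
  rw [op, map_mul]
  exact CStarRing.norm_mul_mem_unitary _ hu

theorem norm_op_unitary_mul {L : ℕ} (u : UL L) (A : Matrix (Fin L) (Fin L) ℂ) :
    ‖op ((u : Matrix (Fin L) (Fin L) ℂ) * A)‖ = ‖op A‖ := by
  have hu : op (u : Matrix (Fin L) (Fin L) ℂ) ∈ unitary (Fib L →L[ℂ] Fib L) :=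
    Unitary.map_mem (Matrix.toEuclideanCLM (n := Fin L) (𝕜 := ℂ)) u.2
  rw [op, map_mul]
  exact CStarRing.norm_mem_unitary_mul _ hu

theorem layerDiag_bounded {L : ℕ} (α : Matrix (Fin L) (Fin L) ℂ) (bl br : UL L) (ω : Sample L)
    (r : ℤ) (I : Set ℤ) : ∃ C, ∀ i : I, ‖op (layerDiag α bl br ω r i)‖ ≤ C := by
  refine ⟨‖op α‖ + ‖op α.conjTranspose‖ + ‖op (br : Matrix (Fin L) (Fin L) ℂ)‖
    + ‖op (bl : Matrix (Fin L) (Fin L) ℂ)‖, fun i => ?_⟩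
  have hD : ∀ n, ‖op (blockD α ω n)‖ = ‖op α.conjTranspose‖ := fun n => by
    rw [blockD, op, map_neg, norm_neg]
    exact (norm_op_mul_unitary _ _).trans (norm_op_unitary_mul _ _)
  have h1 := norm_nonneg (op α)
  have h2 := norm_nonneg (op α.conjTranspose)
  have h3 := norm_nonneg (op (br : Matrix (Fin L) (Fin L) ℂ))
  have h4 := norm_nonneg (op (bl : Matrix (Fin L) (Fin L) ℂ))
  unfold layerDiag
  split_ifs
  · linarith
  · rw [hD]; linarith
  · linarith
  · linarith

theorem layerOff_bounded {L : ℕ} (α : Matrix (Fin L) (Fin L) ℂ) (ω : Sample L)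
    (r : ℤ) (I : Set ℤ) : ∃ C, ∀ i : I, ‖op (layerOff α ω r i)‖ ≤ C := by
  refine ⟨‖op (rho α)‖ + ‖op (rhoT α)‖, fun i => ?_⟩
  have h1 := norm_nonneg (op (rho α))
  have h2 := norm_nonneg (op (rhoT α))
  unfold layerOff
  split_ifs
  · rw [blockB, norm_op_mul_unitary]; linarith
  · rw [blockC, norm_op_unitary_mul]; linarith
  · rw [op, map_zero, norm_zero]; linarith

/-- The layer of parity `r`: the direct sum of the scattering matrices `S^{(n)}_ω`, `n ≡ r`
modulo `2`, acting on the sites `(n, n+1)`, for the pairs `{n, n+1}` inside `I`, and of the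
boundary conditions on the sites of `I` whose pair is cut. -/
noncomputable def layer {L : ℕ} (α : Matrix (Fin L) (Fin L) ℂ) (bl br : UL L) (I : Set ℤ)
    (ω : Sample L) (r : ℤ) : Hil L I →L[ℂ] Hil L I :=
  diagOp (fun i => op (layerDiag α bl br ω r i)) (layerDiag_bounded α bl br ω r I) +
    diagOp (fun i => op (layerOff α ω r i)) (layerOff_bounded α ω r I) ∘L
      reindexOp (mateIn r) (mateIn_injective r I)

/-- `𝕌_ω^{[a,b]} = 𝕍_ω^{[a,b]} 𝕎_ω^{[a,b]}`, where `𝕍` carries the scattering matrices of even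
index and `𝕎` those of odd index; `bl` is the boundary condition at `a` (if `a` is finite) and `br`
the one at `b` (if `b` is finite). -/
noncomputable def zipper {L : ℕ} (α : Matrix (Fin L) (Fin L) ℂ) (bl br : UL L)
    (a b : WithBot (WithTop ℤ)) (ω : Sample L) :
    Hil L (sites a b) →L[ℂ] Hil L (sites a b) :=
  layer α bl br (sites a b) ω 0 ∘L layer α bl br (sites a b) ω 1

/-- The resolvent `(𝕌_ω^{[a,b]} - z)^{-1}`. -/
noncomputable def resolventOp {L : ℕ} (α : Matrix (Fin L) (Fin L) ℂ) (bl br : UL L)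
    (a b : WithBot (WithTop ℤ)) (ω : Sample L) (z : ℂ) :
    Hil L (sites a b) →L[ℂ] Hil L (sites a b) :=
  Ring.inverse (zipper α bl br a b ω - z • ContinuousLinearMap.id ℂ _)

open Classical in
/-- The canonical basis vector `e_{k,q}` of `ℓ²(I, ℂ^L)`. -/
noncomputable def basisVec {L : ℕ} {I : Set ℤ} (k : I) (q : Fin L) : Hil L I :=
  lp.single 2 k (EuclideanSpace.single q (1 : ℂ))

/-- The `L × L` block `G_ω^{[a,b]}(z,k,l)` of the Green kernel, with entries
`⟨e_{k,p}, (𝕌_ω^{[a,b]} - z)^{-1} e_{l,q}⟩`. -/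
noncomputable def green {L : ℕ} (α : Matrix (Fin L) (Fin L) ℂ) (bl br : UL L)
    (a b : WithBot (WithTop ℤ)) (ω : Sample L) (z : ℂ) (k l : sites a b) :
    Matrix (Fin L) (Fin L) ℂ :=
  Matrix.of fun p q => inner ℂ (basisVec k p) (resolventOp α bl br a b ω z (basisVec l q))

/-- The matrix norm subordinate to a norm `N` on `ℂ^L`. -/
noncomputable def subordinateNorm {L : ℕ} (N : Seminorm ℂ (Fin L → ℂ))
    (A : Matrix (Fin L) (Fin L) ℂ) : ℝ :=
  sSup ((fun x => N (A.mulVec x)) '' {x | N x ≤ 1})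

end ScatteringZipper

open ScatteringZipper

/-! The square-root identities make every scattering matrix unitary, so both layers and $\mathbb
U=\mathbb V\mathbb W$ are unitary and $\mathbb U-z$ is invertible off the unit circle. The moment
bound is a two-phase averaging argument: all the randomness is frozen except one angle attached to
the row site and one attached to the column site.

A site $k$ with $k-1$ in the interval carries random phases: those of $V^{(k-1)}$, at the far left
of $\mathbb U$, if $k$ is odd, and those of $U^{(k-1)}$, at the far right, if $k$ is even. Changing
one angle multiplies $\mathbb U$, on the corresponding side, by a unitary acting on a single line,
spanned by a vector that does not depend on the angles (`zipper_setAngle`). For two different sites,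
with line vectors $x,y$, all phases can be moved to the left (`exists_linePhase_left`). A Schur
complement on the span of $x$ and $y$ then shows that $\langle x,(\mathbb U-z)^{-1}y\rangle$ is a
fraction whose numerator has modulus at most 1 and whose denominator is affine in each phase
(`exists_resolvent_formula`). Since $|c+e^{i\theta}|^{-s}$ has a mean bounded uniformly in $c$ for
$s<1$, two successive integrations give a bound independent of $z$
(`lintegral_resolvent_linePhase_le`). The case $|z|<1$ is reduced to $|z|>1$ by passing to $\mathbb
U^{-1}$. The law is invariant under resampling an angle, so the bound passes to the full expectation
(`lintegral_law_le_of_setAngle`).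

The left endpoint of the interval, if finite, carries no phase. For $|z|$ near 1 the resolvent
equation at that site, together with $\|\alpha\|<1$, bounds the solution there by its value at the
right neighbour (`norm_apply_le_of_boundary`); the adjoint equation does the same for columns. For
$|z|$ away from 1 the resolvent is bounded deterministically (`norm_green_le_of_far`). -/

namespace ScatteringZipper

/-! ### Square roots $\rho$, $\tilde\rho$ and their intertwining with $\alpha$. -/

section Matrices

open scoped MatrixOrder ComplexOrder

variable {L : ℕ} {α : Matrix (Fin L) (Fin L) ℂ}

theorem norm_op_conjTranspose (α : Matrix (Fin L) (Fin L) ℂ) : ‖op α.conjTranspose‖ = ‖op α‖ := by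
  have : op α.conjTranspose = star (op α) := map_star (Matrix.toEuclideanCLM (n := Fin L) (𝕜 := ℂ)) α
  rw [this, ContinuousLinearMap.star_eq_adjoint]
  exact (ContinuousLinearMap.adjoint (𝕜 := ℂ)).norm_map _

theorem posDef_one_sub_conjTranspose_mul (hα : ‖op α‖ < 1) :
    (1 - α.conjTranspose * α).PosDef := by
  refine Matrix.PosDef.of_dotProduct_mulVec_pos ?_ ?_
  · simp [Matrix.IsHermitian]
  · intro x hx
    have h1 : ‖op α (WithLp.toLp 2 x)‖ < ‖WithLp.toLp 2 x‖ := by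
      have h0 : 0 < ‖(WithLp.toLp 2 x : Fib L)‖ := by
        rw [norm_pos_iff]; simpa using hx
      calc _ ≤ ‖op α‖ * ‖WithLp.toLp 2 x‖ := (op α).le_opNorm _
        _ < _ := by nlinarith
    have h2 : star x ⬝ᵥ (1 - α.conjTranspose * α).mulVec x
        = ((‖(WithLp.toLp 2 x : Fib L)‖ ^ 2 - ‖op α (WithLp.toLp 2 x)‖ ^ 2 : ℝ) : ℂ) := by
      have e1 : star x ⬝ᵥ x = ((‖(WithLp.toLp 2 x : Fib L)‖ : ℂ)) ^ 2 := by
        have h := inner_self_eq_norm_sq_to_K (𝕜 := ℂ) (WithLp.toLp 2 x : Fib L)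
        rw [EuclideanSpace.inner_eq_star_dotProduct, dotProduct_comm] at h
        exact h
      have e2 : star x ⬝ᵥ (α.conjTranspose * α).mulVec x
          = ((‖op α (WithLp.toLp 2 x)‖ : ℂ)) ^ 2 := by
        have h := inner_self_eq_norm_sq_to_K (𝕜 := ℂ) (op α (WithLp.toLp 2 x))
        rw [EuclideanSpace.inner_eq_star_dotProduct, dotProduct_comm] at h
        rw [← Matrix.mulVec_mulVec, Matrix.dotProduct_mulVec, ← Matrix.star_mulVec]
        exact h
      rw [Matrix.sub_mulVec, dotProduct_sub, Matrix.one_mulVec, e1, e2]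
      push_cast
      rfl
    rw [h2, Complex.zero_lt_real]
    have := norm_nonneg (op α (WithLp.toLp 2 x))
    nlinarith

theorem posDef_one_sub_mul_conjTranspose (hα : ‖op α‖ < 1) :
    (1 - α * α.conjTranspose).PosDef := by
  have h := posDef_one_sub_conjTranspose_mul (α := α.conjTranspose) (by rwa [norm_op_conjTranspose])
  simpa using h

theorem rho_mul_rho (hα : ‖op α‖ < 1) : rho α * rho α = 1 - α * α.conjTranspose :=
  CFC.sqrt_mul_sqrt_self _ (posDef_one_sub_mul_conjTranspose hα).posSemidef.nonneg

theorem rhoT_mul_rhoT (hα : ‖op α‖ < 1) : rhoT α * rhoT α = 1 - α.conjTranspose * α :=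
  CFC.sqrt_mul_sqrt_self _ (posDef_one_sub_conjTranspose_mul hα).posSemidef.nonneg

theorem posSemidef_rho : (rho α).PosSemidef := Matrix.nonneg_iff_posSemidef.1 (CFC.sqrt_nonneg _)

theorem posSemidef_rhoT : (rhoT α).PosSemidef := Matrix.nonneg_iff_posSemidef.1 (CFC.sqrt_nonneg _)

theorem conjTranspose_rho : (rho α).conjTranspose = rho α := posSemidef_rho.1

theorem conjTranspose_rhoT : (rhoT α).conjTranspose = rhoT α := posSemidef_rhoT.1

theorem posDef_rho (hα : ‖op α‖ < 1) : (rho α).PosDef := by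
  refine posSemidef_rho.posDef_iff_isUnit.2 ?_
  have h : IsUnit (rho α * rho α) := by
    rw [rho_mul_rho hα]; exact (posDef_one_sub_mul_conjTranspose hα).isUnit
  exact isUnit_of_mul_isUnit_left h

/-- A solution of the homogeneous Sylvester equation `P X + X Q = 0` with `P` positive definite and
`Q` positive semidefinite vanishes. -/
theorem eq_zero_of_sylvester {P Q X : Matrix (Fin L) (Fin L) ℂ} (hP : P.PosDef)
    (hQ : Q.PosSemidef) (h : P * X + X * Q = 0) : X = 0 := by
  have h1 : (X.conjTranspose * P * X).PosSemidef := hP.posSemidef.conjTranspose_mul_mul_same X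
  have h2 : (X * Q * X.conjTranspose).PosSemidef := hQ.mul_mul_conjTranspose_same X
  -- By cyclicity the sum is $\operatorname{tr}(X^*(PX+XQ))$; both summands are nonnegative, so each
  -- vanishes.
  have h3 : (X.conjTranspose * P * X).trace + (X * Q * X.conjTranspose).trace = 0 := by
    rw [Matrix.trace_mul_comm (X * Q), ← Matrix.trace_add, Matrix.mul_assoc, ← Matrix.mul_add, h]
    simp
  have h4 : (X.conjTranspose * P * X).trace = 0 := by
    have h5 := h1.trace_nonneg
    have h6 := h2.trace_nonneg
    refine le_antisymm ?_ h5
    rw [← h3]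
    exact le_add_of_nonneg_right h6
  rw [h1.trace_eq_zero_iff] at h4
  refine Matrix.mulVec_injective ?_
  funext v
  by_contra hv
  have hv' : X.mulVec v ≠ 0 := by simpa using hv
  have := hP.dotProduct_mulVec_pos hv'
  rw [Matrix.star_mulVec, ← Matrix.dotProduct_mulVec, Matrix.mulVec_mulVec, Matrix.mulVec_mulVec, h4] at this
  simp at this

/-- The defect $X=\rho\alpha-\alpha\tilde\rho$ satisfies $\rho
X+X\tilde\rho=\rho^2\alpha-\alpha\tilde\rho^2=0$. This Sylvester equation replaces an approximation
of the square root by polynomials. -/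
theorem rho_mul_self (hα : ‖op α‖ < 1) : rho α * α = α * rhoT α := by
  rw [← sub_eq_zero]
  refine eq_zero_of_sylvester (posDef_rho hα) posSemidef_rhoT (Q := rhoT α) ?_
  have : rho α * (rho α * α - α * rhoT α) + (rho α * α - α * rhoT α) * rhoT α
      = (rho α * rho α) * α - α * (rhoT α * rhoT α) := by noncomm_ring
  rw [this, rho_mul_rho hα, rhoT_mul_rhoT hα]
  noncomm_ring

theorem conjTranspose_mul_rho (hα : ‖op α‖ < 1) :
    α.conjTranspose * rho α = rhoT α * α.conjTranspose := by
  have := congrArg Matrix.conjTranspose (rho_mul_self hα)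
  simpa [conjTranspose_rho, conjTranspose_rhoT] using this

end Matrices

/-! ### Unitarity of the layers and of the zipper. -/

section Layers

variable {L : ℕ} {I : Set ℤ}

theorem diagOp_apply (A : I → Fib L →L[ℂ] Fib L) (hA : ∃ C, ∀ i, ‖A i‖ ≤ C) (f : Hil L I) (i : I) :
    diagOp A hA f i = A i (f i) := rfl

theorem reindexOp_apply (σ : I → I) (hσ : Function.Injective σ) (f : Hil L I) (i : I) :
    reindexOp σ hσ f i = f (σ i) := rfl

theorem layer_apply (α : Matrix (Fin L) (Fin L) ℂ) (bl br : UL L) (ω : Sample L) (r : ℤ)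
    (f : Hil L I) (i : I) :
    layer α bl br I ω r f i =
      op (layerDiag α bl br ω r i) (f i) + op (layerOff α ω r i) (f (mateIn r i)) := rfl

theorem op_conjTranspose (A : Matrix (Fin L) (Fin L) ℂ) :
    op A.conjTranspose = ContinuousLinearMap.adjoint (op A) :=
  map_star (Matrix.toEuclideanCLM (n := Fin L) (𝕜 := ℂ)) A

theorem op_mul_apply (A B : Matrix (Fin L) (Fin L) ℂ) (v : Fib L) :
    op (A * B) v = op A (op B v) := by
  rw [op, map_mul]; rfl

theorem mateIn_involutive (r : ℤ) : Function.Involutive (mateIn r (I := I)) := by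
  intro i
  apply Subtype.ext
  by_cases hi : mate r i ∈ I
  · simp [mateIn, hi, mate_mate]
  · simp [mateIn, hi]

theorem adjoint_diagOp (A : I → Fib L →L[ℂ] Fib L) (hA : ∃ C, ∀ i, ‖A i‖ ≤ C)
    (hA' : ∃ C, ∀ i, ‖ContinuousLinearMap.adjoint (A i)‖ ≤ C) :
    ContinuousLinearMap.adjoint (diagOp A hA) =
      diagOp (fun i => ContinuousLinearMap.adjoint (A i)) hA' := by
  symm
  rw [ContinuousLinearMap.eq_adjoint_iff]
  intro f g
  rw [lp.inner_eq_tsum, lp.inner_eq_tsum]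
  refine tsum_congr fun i => ?_
  rw [diagOp_apply, diagOp_apply, ContinuousLinearMap.adjoint_inner_left]

theorem adjoint_reindexOp (σ : I → I) (hσ : Function.Involutive σ) :
    ContinuousLinearMap.adjoint (reindexOp (L := L) σ hσ.injective) =
      reindexOp σ hσ.injective := by
  symm
  rw [ContinuousLinearMap.eq_adjoint_iff]
  intro f g
  rw [lp.inner_eq_tsum, lp.inner_eq_tsum, ← (hσ.toPerm σ).tsum_eq]
  refine tsum_congr fun i => ?_
  rw [reindexOp_apply, reindexOp_apply, Function.Involutive.coe_toPerm, hσ i]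

theorem adjoint_layer_apply (α : Matrix (Fin L) (Fin L) ℂ) (bl br : UL L) (ω : Sample L) (r : ℤ)
    (f : Hil L I) (i : I) :
    ContinuousLinearMap.adjoint (layer α bl br I ω r) f i =
      op (layerDiag α bl br ω r i).conjTranspose (f i) +
        op (layerOff α ω r (mateIn r i)).conjTranspose (f (mateIn r i)) := by
  have h : ∀ A : I → Fib L →L[ℂ] Fib L, (∃ C, ∀ i, ‖A i‖ ≤ C) →
      ∃ C, ∀ i, ‖ContinuousLinearMap.adjoint (A i)‖ ≤ C := by
    rintro A ⟨C, hC⟩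
    exact ⟨C, fun i => (ContinuousLinearMap.adjoint.norm_map (A i)).trans_le (hC i)⟩
  rw [layer, map_add, ContinuousLinearMap.adjoint_comp,
    adjoint_diagOp _ _ (h _ (layerDiag_bounded α bl br ω r I)),
    adjoint_diagOp _ _ (h _ (layerOff_bounded α ω r I)),
    adjoint_reindexOp _ (mateIn_involutive r), op_conjTranspose, op_conjTranspose]
  rfl

theorem unitary_mul_conjTranspose (u : UL L) :
    (u : Matrix (Fin L) (Fin L) ℂ) * (u : Matrix (Fin L) (Fin L) ℂ).conjTranspose = 1 :=
  Matrix.mem_unitaryGroup_iff.1 u.2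

theorem unitary_conjTranspose_mul (u : UL L) :
    (u : Matrix (Fin L) (Fin L) ℂ).conjTranspose * (u : Matrix (Fin L) (Fin L) ℂ) = 1 :=
  Matrix.mem_unitaryGroup_iff'.1 u.2

theorem unitary_mul_conjTranspose_mul (u : UL L) (A : Matrix (Fin L) (Fin L) ℂ) :
    (u : Matrix (Fin L) (Fin L) ℂ) * ((u : Matrix (Fin L) (Fin L) ℂ).conjTranspose * A) = A := by
  rw [← Matrix.mul_assoc, unitary_mul_conjTranspose, Matrix.one_mul]

theorem unitary_conjTranspose_mul_mul (u : UL L) (A : Matrix (Fin L) (Fin L) ℂ) :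
    (u : Matrix (Fin L) (Fin L) ℂ).conjTranspose * ((u : Matrix (Fin L) (Fin L) ℂ) * A) = A := by
  rw [← Matrix.mul_assoc, unitary_conjTranspose_mul, Matrix.one_mul]

theorem layerDiag_of_notMem {α : Matrix (Fin L) (Fin L) ℂ} {bl br : UL L} {ω : Sample L} {r : ℤ}
    {i : I} (hi : mate r i ∉ I) :
    ∃ u : UL L, layerDiag α bl br ω r i = u := by
  unfold layerDiag
  rw [if_neg hi]
  split_ifs
  exacts [⟨br, rfl⟩, ⟨bl, rfl⟩]

theorem mate_of_even {r i : ℤ} (h : Even (i - r)) : mate r i = i + 1 := if_pos h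

theorem mate_of_not_even {r i : ℤ} (h : ¬ Even (i - r)) : mate r i = i - 1 := if_neg h

theorem mateIn_of_mem {r : ℤ} {i : I} (hi : mate r i ∈ I) : mateIn r i = ⟨mate r i, hi⟩ :=
  dif_pos hi

theorem mateIn_of_notMem {r : ℤ} {i : I} (hi : mate r i ∉ I) : mateIn r i = i := dif_neg hi

/-- The four blocks attached to a site whose mate lies in `I`. -/
theorem layer_blocks_of_mem (α : Matrix (Fin L) (Fin L) ℂ) (bl br : UL L) (ω : Sample L) {r : ℤ}
    {i : I} (hi : mate r i ∈ I) :
    (Even ((i : ℤ) - r) ∧ layerDiag α bl br ω r i = α ∧ layerOff α ω r i = blockB α ω i ∧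
      layerDiag α bl br ω r (mateIn r i) = blockD α ω i ∧
      layerOff α ω r (mateIn r i) = blockC α ω i) ∨
    (¬ Even ((i : ℤ) - r) ∧ layerDiag α bl br ω r i = blockD α ω (i - 1) ∧
      layerOff α ω r i = blockC α ω (i - 1) ∧
      layerDiag α bl br ω r (mateIn r i) = α ∧
      layerOff α ω r (mateIn r i) = blockB α ω (i - 1)) := by
  have hm : mate r (mate r i) ∈ I := by rw [mate_mate]; exact i.2
  rw [mateIn_of_mem hi]
  by_cases h : Even ((i : ℤ) - r)
  · left
    have h' : ¬ Even (mate r i - r) := by rw [mate_of_even h]; grind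
    refine ⟨h, ?_, ?_, ?_, ?_⟩
    · simp [layerDiag, hi, h]
    · simp [layerOff, hi, h]
    · simp only [layerDiag, hm, h', if_true, if_false]
      rw [mate_of_even h, add_sub_cancel_right]
    · simp only [layerOff, hm, h', if_true, if_false]
      rw [mate_of_even h, add_sub_cancel_right]
  · right
    have h' : Even (mate r i - r) := by rw [mate_of_not_even h]; grind
    refine ⟨h, ?_, ?_, ?_, ?_⟩
    · simp [layerDiag, hi, h]
    · simp [layerOff, hi, h]
    · simp [layerDiag, hm, h']
    · simp only [layerOff, hm, h', if_true]
      rw [mate_of_not_even h]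

theorem layerOff_of_notMem {α : Matrix (Fin L) (Fin L) ℂ} {ω : Sample L} {r : ℤ} {i : I}
    (hi : mate r i ∉ I) : layerOff α ω r i = 0 := if_neg hi

variable {α : Matrix (Fin L) (Fin L) ℂ}

/-- The scattering matrices and the boundary conditions are isometric. -/
theorem layer_blocks_isometry (hα : ‖op α‖ < 1) (bl br : UL L) (ω : Sample L) (r : ℤ) (i : I) :
    ((layerDiag α bl br ω r i).conjTranspose * layerDiag α bl br ω r i +
      (layerOff α ω r (mateIn r i)).conjTranspose * layerOff α ω r (mateIn r i) = 1) ∧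
    ((layerDiag α bl br ω r i).conjTranspose * layerOff α ω r i +
      (layerOff α ω r (mateIn r i)).conjTranspose * layerDiag α bl br ω r (mateIn r i) = 0) := by
  by_cases hi : mate r i ∈ I
  · rcases layer_blocks_of_mem α bl br ω hi with ⟨-, h1, h2, h3, h4⟩ | ⟨-, h1, h2, h3, h4⟩
    · rw [h1, h2, h3, h4]
      simp only [blockB, blockC, blockD, Matrix.conjTranspose_mul, conjTranspose_rhoT,
        Matrix.mul_assoc, unitary_conjTranspose_mul_mul, Matrix.mul_neg]
      -- The diagonal identity is $\alpha^*\alpha+\tilde\rho^2=1$; the off-diagonal one cancels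
      -- because $\alpha^*\rho=\tilde\rho\alpha^*$.
      rw [rhoT_mul_rhoT hα, ← Matrix.mul_assoc α.conjTranspose, conjTranspose_mul_rho hα,
        Matrix.mul_assoc]
      constructor <;> simp
    · rw [h1, h2, h3, h4]
      simp only [blockB, blockC, blockD, Matrix.conjTranspose_mul, Matrix.conjTranspose_neg,
        conjTranspose_rho, Matrix.mul_assoc, unitary_conjTranspose_mul_mul,
        Matrix.mul_neg, Matrix.neg_mul, neg_neg, Matrix.conjTranspose_conjTranspose]
      rw [← Matrix.mul_assoc (rho α), rho_mul_rho hα, rho_mul_self hα]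
      constructor
      · rw [Matrix.sub_mul, Matrix.mul_sub, Matrix.one_mul, unitary_conjTranspose_mul,
          Matrix.mul_assoc]
        abel
      · abel
  · obtain ⟨u, hu⟩ := layerDiag_of_notMem (α := α) (bl := bl) (br := br) (ω := ω) hi
    rw [mateIn_of_notMem hi, hu, layerOff_of_notMem hi, unitary_conjTranspose_mul]
    simp

/-- The scattering matrices and the boundary conditions are co-isometric. -/
theorem layer_blocks_coisometry (hα : ‖op α‖ < 1) (bl br : UL L) (ω : Sample L) (r : ℤ) (i : I) :
    (layerDiag α bl br ω r i * (layerDiag α bl br ω r i).conjTranspose +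
      layerOff α ω r i * (layerOff α ω r i).conjTranspose = 1) ∧
    (layerDiag α bl br ω r i * (layerOff α ω r (mateIn r i)).conjTranspose +
      layerOff α ω r i * (layerDiag α bl br ω r (mateIn r i)).conjTranspose = 0) := by
  by_cases hi : mate r i ∈ I
  · rcases layer_blocks_of_mem α bl br ω hi with ⟨-, h1, h2, h3, h4⟩ | ⟨-, h1, h2, h3, h4⟩
    · rw [h1, h2, h3, h4]
      simp only [blockB, blockC, blockD, Matrix.conjTranspose_mul, Matrix.conjTranspose_neg,
        conjTranspose_rhoT, conjTranspose_rho, Matrix.mul_assoc, unitary_mul_conjTranspose_mul,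
        Matrix.mul_neg, Matrix.conjTranspose_conjTranspose]
      rw [rho_mul_rho hα, ← Matrix.mul_assoc (rho α), rho_mul_self hα, Matrix.mul_assoc]
      constructor <;> simp
    · rw [h1, h2, h3, h4]
      simp only [blockB, blockC, blockD, Matrix.conjTranspose_mul, Matrix.conjTranspose_neg,
        conjTranspose_rhoT, conjTranspose_rho, Matrix.mul_assoc, unitary_mul_conjTranspose_mul,
        Matrix.mul_neg, Matrix.neg_mul, neg_neg, Matrix.conjTranspose_conjTranspose]
      rw [← Matrix.mul_assoc (rhoT α), rhoT_mul_rhoT hα, conjTranspose_mul_rho hα]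
      constructor
      · rw [Matrix.sub_mul, Matrix.mul_sub, Matrix.one_mul, unitary_mul_conjTranspose,
          Matrix.mul_assoc]
        abel
      · abel
  · obtain ⟨u, hu⟩ := layerDiag_of_notMem (α := α) (bl := bl) (br := br) (ω := ω) hi
    rw [mateIn_of_notMem hi, hu, layerOff_of_notMem hi, unitary_mul_conjTranspose]
    simp

theorem op_add_apply (A B : Matrix (Fin L) (Fin L) ℂ) (v : Fib L) :
    op (A + B) v = op A v + op B v := by rw [op, map_add]; rfl

theorem op_one_apply (v : Fib L) : op (1 : Matrix (Fin L) (Fin L) ℂ) v = v := by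
  rw [op, map_one]; rfl

theorem op_zero_apply (v : Fib L) : op (0 : Matrix (Fin L) (Fin L) ℂ) v = 0 := by
  rw [op, map_zero]; rfl

/-- At a site $i$ both products involve only $f(i)$ and the value at its mate, because `mateIn` is
an involution. The two coefficients are exactly the block identities; at a cut site, where the mate
is $i$ itself, the off-diagonal block is zero. -/
theorem layer_mem_unitary (hα : ‖op α‖ < 1) (bl br : UL L) (I : Set ℤ) (ω : Sample L) (r : ℤ) :
    layer α bl br I ω r ∈ unitary (Hil L I →L[ℂ] Hil L I) := by
  rw [Unitary.mem_iff, ContinuousLinearMap.star_eq_adjoint]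
  constructor
  · ext1 f
    ext1
    funext i
    obtain ⟨h1, h2⟩ := layer_blocks_isometry hα bl br ω r i
    have e1 := congrArg (fun M => op M (f i)) h1
    have e2 := congrArg (fun M => op M (f (mateIn r i))) h2
    simp only [op_add_apply, op_mul_apply, op_one_apply, op_zero_apply] at e1 e2
    rw [mul_apply_eq_comp, adjoint_layer_apply, layer_apply, layer_apply,
      mateIn_involutive, map_add, map_add, one_apply_eq_self]
    rw [add_comm (op (layerOff α ω r (mateIn r i)).conjTranspose _), add_add_add_comm, e1, e2,
      add_zero]
  · ext1 f
    ext1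
    funext i
    obtain ⟨h1, h2⟩ := layer_blocks_coisometry hα bl br ω r i
    have e1 := congrArg (fun M => op M (f i)) h1
    have e2 := congrArg (fun M => op M (f (mateIn r i))) h2
    simp only [op_add_apply, op_mul_apply, op_one_apply, op_zero_apply] at e1 e2
    rw [mul_apply_eq_comp, layer_apply, adjoint_layer_apply, adjoint_layer_apply,
      mateIn_involutive, map_add, map_add, one_apply_eq_self]
    rw [add_comm (op (layerOff α ω r i) _), add_add_add_comm, e1, e2, add_zero]

theorem zipper_mem_unitary (hα : ‖op α‖ < 1) (bl br : UL L) (a b : WithBot (WithTop ℤ))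
    (ω : Sample L) :
    zipper α bl br a b ω ∈ unitary (Hil L (sites a b) →L[ℂ] Hil L (sites a b)) :=
  mul_mem (layer_mem_unitary hα bl br _ ω 0) (layer_mem_unitary hα bl br _ ω 1)

theorem isUnit_zipper_sub (hα : ‖op α‖ < 1) (bl br : UL L) (a b : WithBot (WithTop ℤ))
    (ω : Sample L) {z : ℂ} (hz : ‖z‖ ≠ 1) :
    IsUnit (zipper α bl br a b ω - z • ContinuousLinearMap.id ℂ (Hil L (sites a b))) := by
  have h : z ∉ spectrum ℂ (zipper α bl br a b ω) := by
    intro hmem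
    have := spectrum.subset_circle_of_unitary (zipper_mem_unitary hα bl br a b ω) hmem
    rw [mem_sphere_zero_iff_norm] at this
    exact hz this
  rw [spectrum.notMem_iff, IsUnit.sub_iff] at h
  rw [Algebra.algebraMap_eq_smul_one] at h
  exact h

end Layers

/-! ### Phases on a line and the rational dependence of the resolvent on two of them. -/

section RankOne

variable {H : Type*} [NormedAddCommGroup H] [InnerProductSpace ℂ H]

/-- The operator multiplying by `u` on the line spanned by the unit vector `x` and acting trivially
on its orthogonal complement. -/
noncomputable def linePhase (x : H) (u : ℂ) : H →L[ℂ] H :=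
  1 + (u - 1) • (innerSL ℂ x).smulRight x

theorem linePhase_apply (x : H) (u : ℂ) (ψ : H) :
    linePhase x u ψ = ψ + ((u - 1) * inner ℂ x ψ) • x := by
  simp [linePhase, mul_smul]

theorem inner_linePhase {x : H} (hx : ‖x‖ = 1) (u : ℂ) (ψ : H) :
    inner ℂ x (linePhase x u ψ) = u * inner ℂ x ψ := by
  have h : inner ℂ x x = (1 : ℂ) := by rw [inner_self_eq_norm_sq_to_K, hx]; simp
  rw [linePhase_apply, inner_add_right, inner_smul_right, h]
  ring

theorem inner_linePhase_of_orthogonal {x y : H} (h : inner ℂ y x = (0 : ℂ)) (u : ℂ) (ψ : H) :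
    inner ℂ y (linePhase x u ψ) = inner ℂ y ψ := by
  rw [linePhase_apply, inner_add_right, inner_smul_right, h]
  ring

theorem linePhase_linePhase {x : H} (hx : ‖x‖ = 1) (u v : ℂ) (ψ : H) :
    linePhase x u (linePhase x v ψ) = linePhase x (u * v) ψ := by
  rw [linePhase_apply x u, inner_linePhase hx, linePhase_apply, linePhase_apply]
  module

theorem linePhase_one (x ψ : H) : linePhase x 1 ψ = ψ := by simp [linePhase_apply]

theorem linePhase_comm {x y : H} (h : inner ℂ x y = (0 : ℂ)) (u v : ℂ) (ψ : H) :
    linePhase x u (linePhase y v ψ) = linePhase y v (linePhase x u ψ) := by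
  rw [linePhase_apply x u, inner_linePhase_of_orthogonal h, linePhase_apply y v (linePhase x u ψ),
    inner_linePhase_of_orthogonal (inner_eq_zero_symm.1 h), linePhase_apply, linePhase_apply]
  module

theorem linePhase_self {x : H} (hx : ‖x‖ = 1) (u : ℂ) : linePhase x u x = u • x := by
  have h : inner ℂ x x = (1 : ℂ) := by rw [inner_self_eq_norm_sq_to_K, hx]; simp
  rw [linePhase_apply, h]
  module

theorem linePhase_of_orthogonal {x y : H} (h : inner ℂ x y = (0 : ℂ)) (u : ℂ) :
    linePhase x u y = y := by
  rw [linePhase_apply, h]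
  simp

/-- Phases put on the right of an operator can be moved to its left. -/
theorem exists_linePhase_left {W : H →L[ℂ] H} {x y : H}
    (hx : ‖x‖ = 1) (hy : ‖y‖ = 1) (hxy : inner ℂ x y = (0 : ℂ)) {z u₁ u₂ v₁ v₂ : ℂ}
    (hu : ‖u₂‖ = 1) (hv : ‖v₂‖ = 1) {ψ : H}
    (h : linePhase x u₁ (linePhase y v₁ (W (linePhase y v₂ (linePhase x u₂ ψ)))) - z • ψ = y) :
    ∃ φ : H, linePhase x (u₁ * u₂) (linePhase y (v₁ * v₂) (W φ)) - z • φ = y ∧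
      ‖(inner ℂ x φ : ℂ)‖ = ‖(inner ℂ x ψ : ℂ)‖ := by
  have hv0 : v₂ ≠ 0 := by rintro rfl; simp at hv
  -- The equation is conjugated by the right-hand phases. This multiplies the source $y$ by its
  -- eigenvalue $v_2$, which the scalar $v_2^{-1}$ removes; both changes leave $|\langle
  -- x,\psi\rangle|$ as it was.
  refine ⟨v₂⁻¹ • linePhase y v₂ (linePhase x u₂ ψ), ?_, ?_⟩
  · have h1 := congrArg (fun φ => v₂⁻¹ • linePhase y v₂ (linePhase x u₂ φ)) h
    simp only [map_sub, map_smul, smul_sub] at h1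
    rw [linePhase_linePhase hx, ← linePhase_comm hxy, linePhase_linePhase hy,
      linePhase_of_orthogonal hxy, linePhase_self hy, smul_smul v₂⁻¹ v₂, inv_mul_cancel₀ hv0, one_smul,
      mul_comm u₂, mul_comm v₂, smul_comm v₂⁻¹ z] at h1
    simpa only [map_smul] using h1
  · rw [inner_smul_right, inner_linePhase_of_orthogonal hxy, inner_linePhase hx, norm_mul, norm_mul,
      norm_inv, hu, hv]
    simp

variable [CompleteSpace H]

/-- Outside the unit disc, an off-diagonal matrix element of the resolvent of a unitary operator is
an explicit rational function of the phases put on the two vectors. -/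
theorem exists_resolvent_formula {W : H →L[ℂ] H} (hW : W ∈ unitary (H →L[ℂ] H)) {x y : H}
    (hx : ‖x‖ = 1) (hy : ‖y‖ = 1) (hxy : inner ℂ x y = (0 : ℂ)) {z : ℂ} (hz : 1 < ‖z‖) :
    ∃ k₁₁ k₁₂ k₂₁ k₂₂ : ℂ, ‖k₁₂‖ ≤ 1 ∧ ∀ (u v : ℂ) (ψ : H),
      linePhase x u (linePhase y v (W ψ)) - z • ψ = y →
      inner ℂ x ψ * ((u * k₁₁ - z) * (v * k₂₂ - z) - u * v * k₁₂ * k₂₁) = -(u * k₁₂) := by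
  have hyx : inner ℂ y x = (0 : ℂ) := inner_eq_zero_symm.1 hxy
  have hxx : inner ℂ x x = (1 : ℂ) := by rw [inner_self_eq_norm_sq_to_K, hx]; simp
  have hyy : inner ℂ y y = (1 : ℂ) := by rw [inner_self_eq_norm_sq_to_K, hy]; simp
  have hz0 : z ≠ 0 := by rintro rfl; norm_num at hz
  -- Orthogonal projection onto the complement of the span of $x$ and $y$. The phases do not act
  -- there, so the equation on its range is free of $u$ and $v$.
  let Q : H →L[ℂ] H := 1 - (innerSL ℂ x).smulRight x - (innerSL ℂ y).smulRight y
  have hQ : ∀ ψ, Q ψ = ψ - (inner ℂ x ψ : ℂ) • x - (inner ℂ y ψ : ℂ) • y := fun ψ => by simp [Q]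
  have hxQ : ∀ ψ, inner ℂ x (Q ψ) = (0 : ℂ) := fun ψ => by
    rw [hQ, inner_sub_right, inner_sub_right, inner_smul_right, inner_smul_right, hxx, hxy]; ring
  have hyQ : ∀ ψ, inner ℂ y (Q ψ) = (0 : ℂ) := fun ψ => by
    rw [hQ, inner_sub_right, inner_sub_right, inner_smul_right, inner_smul_right, hyy, hyx]; ring
  have hQQ : ∀ ψ, Q (Q ψ) = Q ψ := fun ψ => by
    rw [hQ (Q ψ), hxQ, hyQ]; simp
  have hsq : ∀ ψ, ‖ψ‖ ^ 2 = ‖(inner ℂ x ψ : ℂ)‖ ^ 2 + ‖(inner ℂ y ψ : ℂ)‖ ^ 2 + ‖Q ψ‖ ^ 2 := by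
    intro ψ
    have e : ψ = (inner ℂ x ψ : ℂ) • x + ((inner ℂ y ψ : ℂ) • y + Q ψ) := by rw [hQ]; abel
    have o1 : inner ℂ ((inner ℂ x ψ : ℂ) • x) ((inner ℂ y ψ : ℂ) • y + Q ψ) = (0 : ℂ) := by
      rw [inner_smul_left, inner_add_right, inner_smul_right, hxy, hxQ]; ring
    have o2 : inner ℂ ((inner ℂ y ψ : ℂ) • y) (Q ψ) = (0 : ℂ) := by
      rw [inner_smul_left, hyQ]; ring
    have p1 := norm_add_sq_eq_norm_sq_add_norm_sq_of_inner_eq_zero _ _ o1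
    have p2 := norm_add_sq_eq_norm_sq_add_norm_sq_of_inner_eq_zero _ _ o2
    rw [← e, norm_smul, hx] at p1
    rw [norm_smul, hy] at p2
    nlinarith
  have hQn : ‖Q‖ ≤ 1 := by
    refine ContinuousLinearMap.opNorm_le_bound _ zero_le_one fun ψ => ?_
    rw [one_mul]
    refine le_of_sq_le_sq ?_ (norm_nonneg _)
    nlinarith [hsq ψ, sq_nonneg ‖(inner ℂ x ψ : ℂ)‖, sq_nonneg ‖(inner ℂ y ψ : ℂ)‖]
  have hWn : ∀ ψ, ‖W ψ‖ = ‖ψ‖ := fun ψ => Unitary.norm_map (⟨W, hW⟩ : unitary (H →L[ℂ] H)) ψ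
  -- Here $|z|>1$ is used: $\|QWQ\|\le1<|z|$, so a Neumann series inverts the complementary block.
  have hunit : IsUnit (Q * W * Q - z • (1 : H →L[ℂ] H)) := by
    have hn : ‖Q * W * Q‖ < ‖z‖ := by
      refine lt_of_le_of_lt (ContinuousLinearMap.opNorm_le_bound _ zero_le_one fun ψ => ?_) hz
      rw [one_mul]
      calc ‖Q (W (Q ψ))‖ ≤ ‖W (Q ψ)‖ := by simpa using Q.le_of_opNorm_le hQn (W (Q ψ))
        _ = ‖Q ψ‖ := hWn _
        _ ≤ ‖ψ‖ := by simpa using Q.le_of_opNorm_le hQn ψ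
    have hn' : ‖z⁻¹ • (Q * W * Q)‖ < 1 := by
      rw [norm_smul, norm_inv]
      rw [inv_mul_lt_iff₀ (by linarith)]
      linarith
    have h1 := isUnit_one_sub_of_norm_lt_one hn'
    have h2 : Q * W * Q - z • (1 : H →L[ℂ] H)
        = (Units.mk0 (-z) (neg_ne_zero.2 hz0)) • (1 - z⁻¹ • (Q * W * Q)) := by
      rw [Units.smul_mk0, smul_sub, smul_smul]
      rw [neg_mul, mul_inv_cancel₀ hz0]
      module
    rw [h2]
    exact h1.smul _
  obtain ⟨R, hR⟩ := hunit
  have hRl : ∀ φ, (↑R⁻¹ : H →L[ℂ] H) (Q (W (Q φ)) - z • φ) = φ := fun φ => by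
    have := congrArg (fun T : H →L[ℂ] H => T φ) R.inv_mul
    simpa [hR] using this
  have hRr : ∀ φ, Q (W (Q ((↑R⁻¹ : H →L[ℂ] H) φ))) - z • (↑R⁻¹ : H →L[ℂ] H) φ = φ := fun φ => by
    have := congrArg (fun T : H →L[ℂ] H => T φ) R.mul_inv
    simpa [hR] using this
  -- The correction $\eta\varphi$ in the complement for which $\varphi+\eta\varphi$ satisfies the
  -- projected equation. The numbers $k_{ij}$ below are the resulting $2\times2$ effective matrix of
  -- $W$ on the span of $x$ and $y$.
  let η : H → H := fun φ => -(↑R⁻¹ : H →L[ℂ] H) (Q (W φ))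
  have hη : ∀ φ, Q (W (Q (η φ))) - z • η φ = -Q (W φ) := fun φ => by
    have := hRr (Q (W φ))
    simp only [η, map_neg, smul_neg]
    convert congrArg Neg.neg this using 1
    abel
  have hη' : ∀ φ, z • η φ = Q (W (Q (η φ) + φ)) := fun φ => by
    have := hη φ
    rw [map_add, map_add]
    rw [sub_eq_iff_eq_add] at this
    rw [this]; abel
  have hηQ : ∀ φ, Q (η φ) = η φ := fun φ => by
    have h1 := congrArg Q (hη' φ)
    rw [map_smul, hQQ, ← hη' φ] at h1
    exact smul_right_injective H hz0 h1
  have hη'' : ∀ φ, Q (W (φ + η φ)) = z • η φ := fun φ => by rw [hη', hηQ, add_comm]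
  refine ⟨inner ℂ x (W (x + η x)), inner ℂ x (W (y + η y)), inner ℂ y (W (x + η x)),
    inner ℂ y (W (y + η y)), ?_, ?_⟩
  -- Isometry of $W$ gives $1+\|\eta y\|^2=|k_{12}|^2+|k_{22}|^2+|z|^2\|\eta y\|^2$; since $|z|>1$,
  -- this forces $|k_{12}|\le1$.
  · have h1 := hsq (W (y + η y))
    have h2 : ‖y + η y‖ ^ 2 = 1 + ‖η y‖ ^ 2 := by
      have o : inner ℂ y (η y) = (0 : ℂ) := by rw [← hηQ, hyQ]
      have := norm_add_sq_eq_norm_sq_add_norm_sq_of_inner_eq_zero _ _ o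
      rw [hy] at this
      nlinarith
    rw [hWn, h2, hη'', norm_smul, mul_pow] at h1
    have h3 : ‖η y‖ ^ 2 ≤ ‖z‖ ^ 2 * ‖η y‖ ^ 2 := le_mul_of_one_le_left (sq_nonneg _) (by nlinarith)
    refine le_of_sq_le_sq ?_ zero_le_one
    nlinarith [sq_nonneg ‖(inner ℂ y (W (y + η y)) : ℂ)‖]
  · intro u v ψ hψ
    have hQψ : Q (W ψ) = z • Q ψ := by
      have h := congrArg Q hψ
      have hQx : Q x = 0 := by rw [hQ, hxx, hyx]; simp
      have hQy : Q y = 0 := by rw [hQ, hyy, hxy]; simp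
      rw [map_sub, linePhase_apply, linePhase_apply, map_add, map_add, map_smul, map_smul, map_smul,
        hQx, hQy, smul_zero, smul_zero, add_zero, add_zero, sub_eq_zero] at h
      exact h
    have hdec : Q ψ = (inner ℂ x ψ : ℂ) • η x + (inner ℂ y ψ : ℂ) • η y := by
      have h1 : Q (W (Q (Q ψ))) - z • Q ψ
          = -((inner ℂ x ψ : ℂ) • Q (W x) + (inner ℂ y ψ : ℂ) • Q (W y)) := by
        rw [hQQ, ← hQψ]
        conv_lhs => enter [1]; rw [hQ ψ]
        rw [map_sub, map_sub, map_smul, map_smul, map_sub, map_sub, map_smul, map_smul]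
        abel
      rw [← hRl (Q ψ), h1]
      simp only [η, map_neg, map_add, map_smul, smul_neg]
      abel
    have hψ' : ψ = (inner ℂ x ψ : ℂ) • (x + η x) + (inner ℂ y ψ : ℂ) • (y + η y) := by
      have h1 := hQ ψ
      rw [hdec] at h1
      rw [smul_add, smul_add, add_add_add_comm, h1]
      abel
    have hWψ : W ψ = (inner ℂ x ψ : ℂ) • W (x + η x) + (inner ℂ y ψ : ℂ) • W (y + η y) := by
      rw [← map_smul, ← map_smul, ← map_add, ← hψ']
    have e1 := congrArg (fun φ => (inner ℂ x φ : ℂ)) hψ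
    have e2 := congrArg (fun φ => (inner ℂ y φ : ℂ)) hψ
    simp only [inner_sub_right, inner_smul_right] at e1 e2
    rw [inner_linePhase hx, inner_linePhase_of_orthogonal hxy, hxy, hWψ, inner_add_right,
      inner_smul_right, inner_smul_right] at e1
    rw [inner_linePhase_of_orthogonal hyx, inner_linePhase hy, hyy, hWψ, inner_add_right,
      inner_smul_right, inner_smul_right] at e2
    -- Cramer's rule: the component along $y$ is eliminated from the two scalar equations.
    linear_combination (v * inner ℂ y (W (y + η y)) - z) * e1 - u * inner ℂ x (W (y + η y)) * e2

/-- Inside the unit disc, the equation for the resolvent of a unitary operator is equivalent to one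
for its inverse at a point outside the unit disc. -/
theorem exists_inverse_equation {W : H →L[ℂ] H} (hW : W ∈ unitary (H →L[ℂ] H)) {x y : H}
    (hx : ‖x‖ = 1) (hy : ‖y‖ = 1) (hxy : inner ℂ x y = (0 : ℂ)) {z u v : ℂ} (hz : z ≠ 0)
    (hu : ‖u‖ = 1) (hv : ‖v‖ = 1) {ψ : H}
    (h : linePhase x u (linePhase y v (W ψ)) - z • ψ = y) :
    ∃ φ : H, linePhase x u⁻¹ (linePhase y v⁻¹ (star W φ)) - z⁻¹ • φ = y ∧
      ‖(inner ℂ x φ : ℂ)‖ = ‖z‖ ^ 2 * ‖(inner ℂ x ψ : ℂ)‖ := by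
  have hu0 : u ≠ 0 := by rintro rfl; simp at hu
  have hv0 : v ≠ 0 := by rintro rfl; simp at hv
  have hWW : star W (W ψ) = ψ := by
    have := congrArg (fun T : H →L[ℂ] H => T ψ) (Unitary.star_mul_self_of_mem hW)
    simpa using this
  -- Writing $D$ for the product of the phases,
  -- $D^{-1}W^*(W\psi)-z^{-1}W\psi=-z^{-1}D^{-1}y=-(zv)^{-1}y$; the scalar $-zv$ restores the source
  -- $y$.
  refine ⟨-(z * v) • W ψ, ?_, ?_⟩
  · have h1 := congrArg (fun φ => v • linePhase x u⁻¹ (linePhase y v⁻¹ φ)) h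
    simp only [map_sub, map_smul, smul_sub] at h1
    rw [← linePhase_comm hxy u, linePhase_linePhase hy, inv_mul_cancel₀ hv0, linePhase_one,
      linePhase_linePhase hx, inv_mul_cancel₀ hu0, linePhase_one, linePhase_self hy, map_smul,
      linePhase_of_orthogonal hxy, smul_smul v v⁻¹, mul_inv_cancel₀ hv0, one_smul] at h1
    rw [map_smul, map_smul, map_smul, hWW, smul_smul z⁻¹, mul_neg, ← mul_assoc,
      inv_mul_cancel₀ hz, one_mul]
    refine Eq.trans ?_ h1
    module
  · have e1 := congrArg (fun φ => (inner ℂ x φ : ℂ)) h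
    simp only [inner_sub_right, inner_smul_right] at e1
    rw [inner_linePhase hx, inner_linePhase_of_orthogonal hxy, hxy, sub_eq_zero] at e1
    have e2 := congrArg norm e1
    rw [norm_mul, norm_mul, hu, one_mul] at e2
    rw [inner_smul_right, norm_mul, norm_neg, norm_mul, hv, e2]
    ring

end RankOne

/-! ### Negative fractional moments on the circle and averaging over two phases. -/

section Circle

open scoped ENNReal

theorem lintegral_abs_rpow_lt_top {s : ℝ} (hs1 : s < 1) (R : ℝ) :
    ∫⁻ t in Set.Icc (-R) R, ENNReal.ofReal |t| ^ (-s) < ∞ := by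
  have h1 : ∫⁻ t in Set.Ioc 0 R, ENNReal.ofReal |t| ^ (-s) < ∞ := by
    have hi : IntegrableOn (fun t : ℝ => t ^ (-s)) (Set.Ioc 0 R) := by
      by_cases hR : 0 ≤ R
      · exact (intervalIntegrable_iff_integrableOn_Ioc_of_le hR).1
          (intervalIntegral.intervalIntegrable_rpow' (by linarith))
      · rw [Set.Ioc_eq_empty (by linarith)]; exact integrableOn_empty
    refine lt_of_le_of_lt (le_of_eq ?_) hi.lintegral_lt_top
    refine setLIntegral_congr_fun measurableSet_Ioc fun t ht => ?_
    rw [abs_of_pos ht.1, ENNReal.ofReal_rpow_of_pos ht.1]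
  have h2 : ∫⁻ t in Set.Ico (-R) 0, ENNReal.ofReal |t| ^ (-s) < ∞ := by
    refine lt_of_le_of_lt (le_of_eq ?_) h1
    have := (Measure.measurePreserving_neg (volume : Measure ℝ)).setLIntegral_comp_preimage_emb
      (MeasurableEquiv.neg ℝ).measurableEmbedding (fun t => ENNReal.ofReal |t| ^ (-s)) (Set.Ioc 0 R)
    simpa using this
  have hsub : Set.Icc (-R) R ⊆ (Set.Ioc 0 R ∪ Set.Ico (-R) 0) ∪ {0} := by
    intro t ht
    rcases lt_trichotomy t 0 with h | h | h
    · exact Or.inl (Or.inr ⟨ht.1, h⟩)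
    · exact Or.inr h
    · exact Or.inl (Or.inl ⟨h, ht.2⟩)
  calc _ ≤ ∫⁻ t in (Set.Ioc 0 R ∪ Set.Ico (-R) 0) ∪ {0}, ENNReal.ofReal |t| ^ (-s) :=
        lintegral_mono_set hsub
    _ ≤ (∫⁻ t in Set.Ioc 0 R ∪ Set.Ico (-R) 0, ENNReal.ofReal |t| ^ (-s)) +
        ∫⁻ t in {0}, ENNReal.ofReal |t| ^ (-s) := lintegral_union_le _ _ _
    _ ≤ ((∫⁻ t in Set.Ioc 0 R, ENNReal.ofReal |t| ^ (-s)) +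
        ∫⁻ t in Set.Ico (-R) 0, ENNReal.ofReal |t| ^ (-s)) + 0 := by
        gcongr
        · exact lintegral_union_le _ _ _
        · simp [Measure.restrict_singleton]
    _ < ∞ := by simp [h1, h2]

/-- The distance between a complex number and a point of the unit circle is bounded below by the
distance of the angles. -/
theorem norm_add_exp_ge (c : ℂ) {θ : ℝ} (h0 : 0 ≤ θ) (h1 : θ ≤ 2 * Real.pi) :
    |θ - Complex.arg (-c)| / Real.pi ≤ ‖c + Complex.exp (θ * Complex.I)‖ ∨
      |θ - (Complex.arg (-c) + 2 * Real.pi)| / Real.pi ≤ ‖c + Complex.exp (θ * Complex.I)‖ := by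
  set φ := Complex.arg (-c) with hφ
  have hφ1 : -Real.pi < φ := Complex.neg_pi_lt_arg _
  have hφ2 : φ ≤ Real.pi := Complex.arg_le_pi _
  have hpi := Real.pi_pos
  have hc : c = -(‖c‖ * Complex.exp (φ * Complex.I)) := by
    have := Complex.norm_mul_exp_arg_mul_I (-c)
    rw [norm_neg] at this
    rw [this, neg_neg]
  -- The point $e^{i\varphi}$ is a nearest point of the circle to $-c$; the triangle inequality
  -- through $-c$ costs the factor 2.
  have hdist : ‖Complex.exp (θ * Complex.I) - Complex.exp (φ * Complex.I)‖
      ≤ 2 * ‖c + Complex.exp (θ * Complex.I)‖ := by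
    have e1 : ‖c + Complex.exp (φ * Complex.I)‖ ≤ ‖c + Complex.exp (θ * Complex.I)‖ := by
      have e2 : c + Complex.exp (φ * Complex.I)
          = ((1 - ‖c‖ : ℝ) : ℂ) * Complex.exp (φ * Complex.I) := by
        conv_lhs => rw [hc]
        push_cast; ring
      rw [e2, norm_mul, Complex.norm_exp_ofReal_mul_I, mul_one, Complex.norm_real, Real.norm_eq_abs]
      have e3 := abs_norm_sub_norm_le (Complex.exp (θ * Complex.I)) (-c)
      rw [Complex.norm_exp_ofReal_mul_I, norm_neg, sub_neg_eq_add, add_comm] at e3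
      exact e3
    calc _ = ‖(c + Complex.exp (θ * Complex.I)) - (c + Complex.exp (φ * Complex.I))‖ := by
          congr 1; ring
      _ ≤ _ := (norm_sub_le _ _).trans (by linarith)
  have hsin : ‖Complex.exp (θ * Complex.I) - Complex.exp (φ * Complex.I)‖
      = 2 * |Real.sin ((θ - φ) / 2)| := by
    have e : Complex.exp (θ * Complex.I) - Complex.exp (φ * Complex.I)
        = Complex.exp (φ * Complex.I) * (Complex.exp (Complex.I * ((θ - φ : ℝ) : ℂ)) - 1) := by
      rw [mul_sub, ← Complex.exp_add, mul_one]
      congr 2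
      push_cast; ring
    rw [e, norm_mul, Complex.norm_exp_ofReal_mul_I, one_mul, Complex.norm_exp_I_mul_ofReal_sub_one,
      norm_mul, Real.norm_eq_abs, Real.norm_eq_abs, abs_two]
  rw [hsin] at hdist
  have key : ∀ t : ℝ, |t / 2| ≤ Real.pi / 2 → |Real.sin (t / 2)| = |Real.sin ((θ - φ) / 2)| →
      |t| / Real.pi ≤ ‖c + Complex.exp (θ * Complex.I)‖ := by
    intro t ht hts
    have h := Real.mul_abs_le_abs_sin ht
    rw [abs_div, abs_two] at h
    have : 2 / Real.pi * (|t| / 2) = |t| / Real.pi := by ring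
    rw [this, hts] at h
    linarith
  -- The difference $\theta-\varphi$ lies in $[-\pi,3\pi)$. Jordan's inequality for the sine of the
  -- half angle applies only on $[-\pi,\pi]$, so the rest is shifted by $2\pi$.
  by_cases h : θ - φ ≤ Real.pi
  · left
    refine key _ ?_ rfl
    rw [abs_le]; constructor <;> linarith
  · right
    refine key _ ?_ ?_
    · rw [abs_le]; constructor <;> linarith
    · have : (θ - (φ + 2 * Real.pi)) / 2 = (θ - φ) / 2 - Real.pi := by ring
      rw [this, Real.sin_sub_pi, abs_neg]

theorem setLIntegral_sub_abs_rpow_le (s : ℝ) {φ R : ℝ} (h1 : -R ≤ -φ)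
    (h2 : 2 * Real.pi - φ ≤ R) :
    ∫⁻ t in Set.Icc 0 (2 * Real.pi), ENNReal.ofReal |t - φ| ^ (-s) ≤
      ∫⁻ t in Set.Icc (-R) R, ENNReal.ofReal |t| ^ (-s) := by
  rw [← lintegral_indicator measurableSet_Icc, ← lintegral_indicator measurableSet_Icc,
    ← lintegral_sub_right_eq_self ((Set.Icc (-R) R).indicator _) φ]
  refine lintegral_mono fun t => ?_
  by_cases ht : t ∈ Set.Icc 0 (2 * Real.pi)
  · have : t - φ ∈ Set.Icc (-R) R := ⟨by linarith [ht.1], by linarith [ht.2]⟩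
    simp only [Set.indicator_of_mem ht, Set.indicator_of_mem this, le_refl]
  · simp only [Set.indicator_of_notMem ht, zero_le]

theorem lintegral_uniformAngle (f : ℝ → ℝ≥0∞) :
    ∫⁻ θ, f θ ∂uniformAngle =
      (ENNReal.ofReal (2 * Real.pi))⁻¹ * ∫⁻ t in Set.Icc 0 (2 * Real.pi), f t := by
  rw [uniformAngle, lintegral_smul_measure, lintegral_subtype_comap measurableSet_Icc, smul_eq_mul]

/-- Negative fractional moments of the distance to a uniform point of the circle. -/
theorem exists_lintegral_circle_le {s : ℝ} (hs0 : 0 < s) (hs1 : s < 1) :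
    ∃ C : ℝ≥0∞, C ≠ ∞ ∧ 1 ≤ C ∧ ∀ c : ℂ,
      ∫⁻ θ, ‖c + Complex.exp ((θ : ℝ) * Complex.I)‖ₑ ^ (-s) ∂uniformAngle ≤ C := by
  have hpi := Real.pi_pos
  set K := ∫⁻ t in Set.Icc (-(4 * Real.pi)) (4 * Real.pi), ENNReal.ofReal |t| ^ (-s) with hK
  have hKtop : K < ∞ := lintegral_abs_rpow_lt_top hs1 _
  -- The two copies of $K$ come from the two possible centres $\varphi$ and $\varphi+2\pi$; the
  -- window $4\pi$ contains both shifted intervals. The added 1 keeps the constant nonzero, which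
  -- matters when it multiplies $\infty$.
  refine ⟨1 + (ENNReal.ofReal (2 * Real.pi))⁻¹ * (ENNReal.ofReal Real.pi ^ s * (K + K)), ?_,
    le_self_add, fun c => ?_⟩
  · have : (ENNReal.ofReal (2 * Real.pi))⁻¹ ≠ ∞ := by simp [hpi]
    have h2 : ENNReal.ofReal Real.pi ^ s ≠ ∞ := by simp [hs0.le]
    finiteness
  refine le_trans ?_ le_add_self
  rw [lintegral_uniformAngle (fun t => ‖c + Complex.exp ((t : ℝ) * Complex.I)‖ₑ ^ (-s))]
  gcongr
  set φ := Complex.arg (-c) with hφ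
  have hφ1 : -Real.pi < φ := Complex.neg_pi_lt_arg _
  have hφ2 : φ ≤ Real.pi := Complex.arg_le_pi _
  have hbound : ∀ a b : ℝ, |a| / Real.pi ≤ b →
      ENNReal.ofReal b ^ (-s) ≤ ENNReal.ofReal Real.pi ^ s * ENNReal.ofReal |a| ^ (-s) := by
    intro a b hab
    rw [ENNReal.rpow_neg, ENNReal.rpow_neg, ENNReal.inv_le_iff_inv_le, ENNReal.mul_inv, inv_inv,
      ← ENNReal.inv_rpow, ← ENNReal.mul_rpow_of_nonneg _ _ hs0.le]
    · refine ENNReal.rpow_le_rpow ?_ hs0.le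
      rw [← ENNReal.ofReal_inv_of_pos hpi, ← ENNReal.ofReal_mul (by positivity)]
      refine ENNReal.ofReal_le_ofReal (le_trans (le_of_eq ?_) hab)
      rw [div_eq_inv_mul]
    · left; simp [hpi]
    · left; simp [hs0.le]
  calc _ ≤ ∫⁻ t in Set.Icc 0 (2 * Real.pi), (ENNReal.ofReal Real.pi ^ s *
          (ENNReal.ofReal |t - φ| ^ (-s) + ENNReal.ofReal |t - (φ + 2 * Real.pi)| ^ (-s))) := by
        refine setLIntegral_mono' measurableSet_Icc fun t ht => ?_
        rw [← ofReal_norm, mul_add]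
        rcases norm_add_exp_ge c ht.1 ht.2 with h | h
        · exact (hbound _ _ h).trans le_self_add
        · exact (hbound _ _ h).trans le_add_self
    _ = ENNReal.ofReal Real.pi ^ s * ((∫⁻ t in Set.Icc 0 (2 * Real.pi),
          ENNReal.ofReal |t - φ| ^ (-s)) + ∫⁻ t in Set.Icc 0 (2 * Real.pi),
          ENNReal.ofReal |t - (φ + 2 * Real.pi)| ^ (-s)) := by
        rw [lintegral_const_mul _ (by fun_prop), lintegral_add_left (by fun_prop)]
    _ ≤ _ := by
        gcongr
        · exact setLIntegral_sub_abs_rpow_le s (by linarith) (by linarith)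
        · exact setLIntegral_sub_abs_rpow_le s (by linarith) (by linarith)

theorem lintegral_affine_circle_le {s : ℝ} (hs0 : 0 < s) {C : ℝ≥0∞} (hC1 : 1 ≤ C)
    (hC : ∀ c : ℂ, ∫⁻ θ, ‖c + Complex.exp ((θ : ℝ) * Complex.I)‖ₑ ^ (-s) ∂uniformAngle ≤ C)
    (p q : ℂ) :
    ∫⁻ θ, ‖p + q * Complex.exp ((θ : ℝ) * Complex.I)‖ₑ ^ (-s) ∂uniformAngle
      ≤ C * ‖q‖ₑ ^ (-s) := by
  by_cases hq : q = 0
  · have : ‖q‖ₑ ^ (-s) = ∞ := by simp [hq, hs0]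
    rw [this, ENNReal.mul_top (by positivity)]
    exact le_top
  · have h : ∀ θ : Set.Icc (0 : ℝ) (2 * Real.pi),
        ‖p + q * Complex.exp ((θ : ℝ) * Complex.I)‖ₑ ^ (-s)
        = ‖p / q + Complex.exp ((θ : ℝ) * Complex.I)‖ₑ ^ (-s) * ‖q‖ₑ ^ (-s) := by
      intro θ
      rw [← ENNReal.mul_rpow_of_ne_top enorm_ne_top enorm_ne_top, ← enorm_mul, add_mul,
        div_mul_cancel₀ _ hq, mul_comm q]
    simp_rw [h]
    rw [lintegral_mul_const _ (by fun_prop)]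
    gcongr
    exact hC _

/-- For $|u|=1$ one has $|p+qu|=|\bar q+\bar p u|$, so the constant term can play the role of the
leading coefficient. -/
theorem lintegral_affine_circle_le' {s : ℝ} (hs0 : 0 < s) {C : ℝ≥0∞} (hC1 : 1 ≤ C)
    (hC : ∀ c : ℂ, ∫⁻ θ, ‖c + Complex.exp ((θ : ℝ) * Complex.I)‖ₑ ^ (-s) ∂uniformAngle ≤ C)
    (p q : ℂ) :
    ∫⁻ θ, ‖p + q * Complex.exp ((θ : ℝ) * Complex.I)‖ₑ ^ (-s) ∂uniformAngle
      ≤ C * ‖p‖ₑ ^ (-s) := by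
  have h : ∀ θ : Set.Icc (0 : ℝ) (2 * Real.pi),
      ‖p + q * Complex.exp ((θ : ℝ) * Complex.I)‖ₑ
      = ‖star q + star p * Complex.exp ((θ : ℝ) * Complex.I)‖ₑ := by
    intro θ
    have e : star q + star p * Complex.exp ((θ : ℝ) * Complex.I)
        = star (p + q * Complex.exp ((θ : ℝ) * Complex.I)) *
          Complex.exp ((θ : ℝ) * Complex.I) := by
      have e1 : star (Complex.exp ((θ : ℝ) * Complex.I)) * Complex.exp ((θ : ℝ) * Complex.I)
          = 1 := by
        have := Complex.conj_mul' (Complex.exp ((θ : ℝ) * Complex.I))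
        rw [Complex.norm_exp_ofReal_mul_I] at this
        simpa using this
      rw [star_add, star_mul']
      linear_combination -star q * e1
    rw [e, ← ofReal_norm, ← ofReal_norm, norm_mul, Complex.norm_exp_ofReal_mul_I, mul_one, norm_star]
  simp_rw [h]
  refine (lintegral_affine_circle_le hs0 hC1 hC _ _).trans (le_of_eq ?_)
  rw [← ofReal_norm, norm_star, ofReal_norm]

/-- The product form of a quotient bound: where $b=0$ the right side is $\infty$, so the denominator
of the resolvent formula never has to be shown nonzero. -/
theorem enorm_rpow_le_of_mul_le_one {s : ℝ} (hs0 : 0 < s) {a b : ℂ} (h : ‖a‖ * ‖b‖ ≤ 1) :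
    ‖a‖ₑ ^ s ≤ ‖b‖ₑ ^ (-s) := by
  rw [ENNReal.rpow_neg, ← ENNReal.inv_rpow]
  refine ENNReal.rpow_le_rpow ?_ hs0.le
  rw [ENNReal.le_inv_iff_mul_le, ← ofReal_norm, ← ofReal_norm, ← ENNReal.ofReal_mul (norm_nonneg _),
    ENNReal.ofReal_le_one]
  exact h

variable {H : Type*} [NormedAddCommGroup H] [InnerProductSpace ℂ H] [CompleteSpace H]

/-- Fractional moments of an off-diagonal matrix element of the resolvent of a unitary operator,
averaged over the phases put on the two vectors. -/
theorem lintegral_resolvent_linePhase_le {s : ℝ} (hs0 : 0 < s) {C : ℝ≥0∞} (hC1 : 1 ≤ C)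
    (hC : ∀ c : ℂ, ∫⁻ θ, ‖c + Complex.exp ((θ : ℝ) * Complex.I)‖ₑ ^ (-s) ∂uniformAngle ≤ C)
    {W : H →L[ℂ] H} (hW : W ∈ unitary (H →L[ℂ] H)) {x y : H}
    (hx : ‖x‖ = 1) (hy : ‖y‖ = 1) (hxy : inner ℂ x y = (0 : ℂ)) {z : ℂ} (hz0 : z ≠ 0)
    (hz : ‖z‖ ≠ 1) (ψ : Set.Icc (0 : ℝ) (2 * Real.pi) → Set.Icc (0 : ℝ) (2 * Real.pi) → H)
    (hψ : ∀ θ η : Set.Icc (0 : ℝ) (2 * Real.pi), ∃ φ, linePhase x (Complex.exp ((θ : ℝ) * Complex.I))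
      (linePhase y (Complex.exp ((η : ℝ) * Complex.I)) (W φ)) - z • φ = y ∧
      ‖(inner ℂ x φ : ℂ)‖ = ‖(inner ℂ x (ψ θ η) : ℂ)‖) :
    ∫⁻ θ, ∫⁻ η, ‖(inner ℂ x (ψ θ η) : ℂ)‖ₑ ^ s ∂uniformAngle ∂uniformAngle ≤ C * C := by
  rcases lt_or_gt_of_ne hz with hlt | hgt
  · have hz' : 1 < ‖z⁻¹‖ := by
      rw [norm_inv]; exact (one_lt_inv₀ (norm_pos_iff.2 hz0)).2 hlt
    obtain ⟨k₁₁, k₁₂, k₂₁, k₂₂, hk, h⟩ :=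
      exists_resolvent_formula (Unitary.star_mem hW) hx hy hxy hz'
    have hb : ∀ θ η, ‖(inner ℂ x (ψ θ η) : ℂ)‖ₑ ^ s ≤
        ‖((z * k₁₁ - Complex.exp ((θ : ℝ) * Complex.I)) * z * k₂₂ - z ^ 2 * k₁₂ * k₂₁) +
          (-(z * k₁₁) + 1 * Complex.exp ((θ : ℝ) * Complex.I)) *
            Complex.exp ((η : ℝ) * Complex.I)‖ₑ ^ (-s) := by
      intro θ η
      refine enorm_rpow_le_of_mul_le_one hs0 ?_
      obtain ⟨φ, h1, h2⟩ := hψ θ η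
      have hu := Complex.norm_exp_ofReal_mul_I θ
      have hv := Complex.norm_exp_ofReal_mul_I η
      have hu0 := Complex.exp_ne_zero ((θ : ℝ) * Complex.I)
      have hv0 := Complex.exp_ne_zero ((η : ℝ) * Complex.I)
      obtain ⟨χ, h3, h4⟩ := exists_inverse_equation hW hx hy hxy hz0 hu hv h1
      have h5 := congrArg norm (h _ _ _ h3)
      generalize Complex.exp ((θ : ℝ) * Complex.I) = u at *
      generalize Complex.exp ((η : ℝ) * Complex.I) = v at *
      rw [norm_mul, h4, h2, norm_neg, norm_mul, norm_inv, hu, inv_one, one_mul] at h5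
      -- The factor $|z|^2$ in `exists_inverse_equation` clears the powers of $z^{-1}$ from the
      -- denominator. The coefficient of $uv$ is then exactly 1, so averaging first over $v$ and
      -- then over $u$ leaves no dependence on $z$.
      have e : ((z * k₁₁ - u) * z * k₂₂ - z ^ 2 * k₁₂ * k₂₁) + (-(z * k₁₁) + 1 * u) * v
          = z ^ 2 * (u * v) * ((u⁻¹ * k₁₁ - z⁻¹) * (v⁻¹ * k₂₂ - z⁻¹)
            - u⁻¹ * v⁻¹ * k₁₂ * k₂₁) := by
        field_simp
        ring
      rw [e, norm_mul, norm_mul, norm_mul, hu, hv, norm_pow]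
      calc _ = ‖k₁₂‖ := by rw [← h5]; ring
        _ ≤ 1 := hk
    calc _ ≤ ∫⁻ θ, C * ‖-(z * k₁₁) + 1 * Complex.exp ((θ : ℝ) * Complex.I)‖ₑ ^ (-s)
          ∂uniformAngle := by
          refine lintegral_mono fun θ => ?_
          exact (lintegral_mono fun η => hb θ η).trans (lintegral_affine_circle_le hs0 hC1 hC _ _)
      _ ≤ C * (C * ‖(1 : ℂ)‖ₑ ^ (-s)) := by
          rw [lintegral_const_mul _ (by fun_prop)]
          gcongr
          exact lintegral_affine_circle_le hs0 hC1 hC _ _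
      _ = C * C := by simp
  · obtain ⟨k₁₁, k₁₂, k₂₁, k₂₂, hk, h⟩ := exists_resolvent_formula hW hx hy hxy hgt
    have hb : ∀ θ η, ‖(inner ℂ x (ψ θ η) : ℂ)‖ₑ ^ s ≤
        ‖(z ^ 2 + (-(z * k₁₁)) * Complex.exp ((θ : ℝ) * Complex.I)) +
          (k₂₂ * (Complex.exp ((θ : ℝ) * Complex.I) * k₁₁ - z) -
            Complex.exp ((θ : ℝ) * Complex.I) * k₁₂ * k₂₁) *
            Complex.exp ((η : ℝ) * Complex.I)‖ₑ ^ (-s) := by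
      intro θ η
      refine enorm_rpow_le_of_mul_le_one hs0 ?_
      obtain ⟨φ, h1, h2⟩ := hψ θ η
      have hu := Complex.norm_exp_ofReal_mul_I θ
      have h5 := congrArg norm (h _ _ _ h1)
      generalize Complex.exp ((θ : ℝ) * Complex.I) = u at *
      generalize Complex.exp ((η : ℝ) * Complex.I) = v at *
      rw [norm_mul, h2, norm_neg, norm_mul, hu, one_mul] at h5
      refine le_trans (le_of_eq ?_) hk
      rw [← h5]
      congr 2
      ring
    -- Outside the disc it is the constant term that is kept at each integration; what remains is
    -- $|z^2|^{-s}\le1$.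
    calc _ ≤ ∫⁻ θ, C * ‖z ^ 2 + (-(z * k₁₁)) * Complex.exp ((θ : ℝ) * Complex.I)‖ₑ ^ (-s)
          ∂uniformAngle := by
          refine lintegral_mono fun θ => ?_
          exact (lintegral_mono fun η => hb θ η).trans (lintegral_affine_circle_le' hs0 hC1 hC _ _)
      _ ≤ C * (C * ‖z ^ 2‖ₑ ^ (-s)) := by
          rw [lintegral_const_mul _ (by fun_prop)]
          gcongr
          exact lintegral_affine_circle_le' hs0 hC1 hC _ _
      _ ≤ C * C := by
          gcongr
          refine mul_le_of_le_one_right' ?_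
          rw [ENNReal.rpow_neg, ENNReal.inv_le_one]
          refine ENNReal.one_le_rpow ?_ hs0
          rw [← ofReal_norm, norm_pow, ENNReal.one_le_ofReal]
          nlinarith

end Circle

/-! ### Invariance of the law under resampling of one angle. -/

section Resampling

/-- Transforming one coordinate of an infinite product by a measure preserving map which uses an
extra independent variable preserves the product measure. -/
theorem measurePreserving_update_infinitePi {ι X T : Type*} [DecidableEq ι] [MeasurableSpace X]
    [MeasurableSpace T] (μ : ι → Measure X) [∀ i, IsProbabilityMeasure (μ i)]
    (ν : Measure T) [IsProbabilityMeasure ν] (n : ι) (g : T × X → X)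
    (hg : MeasurePreserving g (ν.prod (μ n)) (μ n)) :
    MeasurePreserving (fun q : T × (ι → X) => Function.update q.2 n (g (q.1, q.2 n)))
      (ν.prod (Measure.infinitePi μ)) (Measure.infinitePi μ) := by
  have hm : Measurable fun q : T × (ι → X) => Function.update q.2 n (g (q.1, q.2 n)) := by
    refine measurable_pi_lambda _ fun i => ?_
    by_cases hi : i = n
    · subst hi
      simp only [Function.update_self]
      exact hg.measurable.comp (by fun_prop)
    · simp only [Function.update_of_ne hi]
      fun_prop
  refine ⟨hm, Measure.eq_infinitePi _ fun s t ht => ?_⟩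
  have hbox : MeasurableSet (Set.pi (s : Set ι) t) :=
    MeasurableSet.pi s.countable_toSet fun i _ => ht i
  rw [Measure.map_apply hm hbox, Measure.prod_apply (hm hbox)]
  have key : ∀ θ : T, Measure.infinitePi μ (Prod.mk θ ⁻¹'
      ((fun q : T × (ι → X) => Function.update q.2 n (g (q.1, q.2 n))) ⁻¹' Set.pi (s : Set ι) t))
      = ∏ i ∈ s, μ i ((if i = n then fun x => g (θ, x) else id) ⁻¹' t i) := by
    intro θ
    rw [← Measure.infinitePi_pi]
    · congr 1
      ext ω
      simp only [Set.mem_preimage, Set.mem_pi]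
      refine forall₂_congr fun i _ => ?_
      by_cases hi : i = n
      · subst hi; simp
      · simp [hi]
    · intro i _
      by_cases hi : i = n
      · simp only [hi, if_true]
        exact (hg.measurable.comp measurable_prodMk_left) (ht n)
      · simp only [hi, if_false]
        exact ht i
  simp_rw [key]
  by_cases hn : n ∈ s
  · have e : ∀ θ, ∏ i ∈ s, μ i ((if i = n then fun x => g (θ, x) else id) ⁻¹' t i)
        = μ n ((fun x => g (θ, x)) ⁻¹' t n) * ∏ i ∈ s.erase n, μ i (t i) := by
      intro θ
      rw [← Finset.mul_prod_erase s _ hn]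
      congr 1
      · simp
      · refine Finset.prod_congr rfl fun i hi => ?_
        simp [Finset.ne_of_mem_erase hi]
    simp_rw [e]
    have hms : MeasurableSet (g ⁻¹' t n) := hg.measurable (ht n)
    have h2 : ∫⁻ θ, μ n ((fun x => g (θ, x)) ⁻¹' t n) ∂ν = μ n (t n) := by
      rw [← hg.measure_preimage (ht n).nullMeasurableSet, Measure.prod_apply hms]
      rfl
    have hmg : Measurable fun θ => μ n ((fun x => g (θ, x)) ⁻¹' t n) :=
      measurable_measure_prodMk_left hms
    rw [lintegral_mul_const _ hmg, h2,
      Finset.mul_prod_erase s (fun i => μ i (t i)) hn]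
  · have e : ∀ θ, ∏ i ∈ s, μ i ((if i = n then fun x => g (θ, x) else id) ⁻¹' t i)
        = ∏ i ∈ s, μ i (t i) := by
      intro θ
      refine Finset.prod_congr rfl fun i hi => ?_
      have : i ≠ n := by rintro rfl; exact hn hi
      simp [this]
    simp_rw [e]
    simp

theorem measurePreserving_prod_fst {T X Y : Type*} [MeasurableSpace T] [MeasurableSpace X]
    [MeasurableSpace Y] {ν : Measure T} {μ : Measure X} {κ : Measure Y} [SFinite ν] [SFinite μ]
    [SFinite κ] {g : T × X → X} (hg : MeasurePreserving g (ν.prod μ) μ) :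
    MeasurePreserving (fun q : T × (X × Y) => (g (q.1, q.2.1), q.2.2)) (ν.prod (μ.prod κ))
      (μ.prod κ) := by
  have h1 : MeasurePreserving (MeasurableEquiv.prodAssoc (α := T) (β := X) (γ := Y)).symm
      (ν.prod (μ.prod κ)) ((ν.prod μ).prod κ) :=
    (measurePreserving_prodAssoc ν μ κ).symm _
  exact (hg.prod (MeasurePreserving.id κ)).comp h1

theorem measurePreserving_prod_snd {T X Y : Type*} [MeasurableSpace T] [MeasurableSpace X]
    [MeasurableSpace Y] {ν : Measure T} {μ : Measure X} {κ : Measure Y} [SFinite ν] [SFinite μ]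
    [SFinite κ] {g : T × X → X} (hg : MeasurePreserving g (ν.prod μ) μ) :
    MeasurePreserving (fun q : T × (Y × X) => (q.2.1, g (q.1, q.2.2))) (ν.prod (κ.prod μ))
      (κ.prod μ) := by
  have h1 : MeasurePreserving (Prod.map id Prod.swap : T × (Y × X) → T × (X × Y))
      (ν.prod (κ.prod μ)) (ν.prod (μ.prod κ)) :=
    (MeasurePreserving.id ν).prod Measure.measurePreserving_swap
  exact Measure.measurePreserving_swap.comp ((measurePreserving_prod_fst hg).comp h1)

variable {L : ℕ}

/-- Replace the angle of index `p`. -/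
noncomputable def setHalfAngle (p : Fin L) (θ : Set.Icc (0 : ℝ) (2 * Real.pi)) (h : HalfSample L) :
    HalfSample L :=
  (h.1, h.2.1, Function.update h.2.2 p θ)

/-- Replace the angle of index `p` in one of the two halves. -/
noncomputable def setSiteAngle (left : Bool) (p : Fin L) (θ : Set.Icc (0 : ℝ) (2 * Real.pi))
    (x : SiteSample L) : SiteSample L :=
  if left then (setHalfAngle p θ x.1, x.2) else (x.1, setHalfAngle p θ x.2)

/-- Replace the angle of index `p` in the phase acting on the site `k`: the one in `V^{(k-1)}` if `k`
is odd, the one in `U^{(k-1)}` if `k` is even. -/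
noncomputable def setAngle (k : ℤ) (p : Fin L) (θ : Set.Icc (0 : ℝ) (2 * Real.pi))
    (ω : Sample L) : Sample L :=
  Function.update ω (k - 1) (setSiteAngle (decide (Odd k)) p θ (ω (k - 1)))

/-- The overwritten angle is uniform and independent of the rest, so a fresh uniform angle changes
nothing. The invariance is lifted from the tuple of angles to the half sample, the site and the
whole sample. -/
theorem measurePreserving_setAngle (k : ℤ) (q : Fin L) {p : ℝ} (h0 : 0 ≤ p) (h1 : p ≤ 1) :
    MeasurePreserving (fun x : Set.Icc (0 : ℝ) (2 * Real.pi) × Sample L => setAngle k q x.1 x.2)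
      (uniformAngle.prod (law L p)) (law L p) := by
  have := isProbabilityMeasure_bernoulliSign h0 h1
  have : IsProbabilityMeasure (halfLaw L p) := by unfold halfLaw; infer_instance
  have : IsProbabilityMeasure (siteLaw L p) := by unfold siteLaw; infer_instance
  have hangle : MeasurePreserving
      (fun x : Set.Icc (0 : ℝ) (2 * Real.pi) × (Fin L → Set.Icc (0 : ℝ) (2 * Real.pi)) =>
        Function.update x.2 q x.1)
      (uniformAngle.prod (Measure.pi fun _ : Fin L => uniformAngle))
      (Measure.pi fun _ : Fin L => uniformAngle) := by
    have := measurePreserving_update_infinitePi (fun _ : Fin L => uniformAngle) uniformAngle q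
      Prod.fst measurePreserving_fst
    rwa [Measure.infinitePi_eq_pi] at this
  have hhalf : MeasurePreserving
      (fun x : Set.Icc (0 : ℝ) (2 * Real.pi) × HalfSample L => setHalfAngle q x.1 x.2)
      (uniformAngle.prod (halfLaw L p)) (halfLaw L p) :=
    measurePreserving_prod_snd (measurePreserving_prod_snd hangle)
  have hsite : MeasurePreserving
      (fun x : Set.Icc (0 : ℝ) (2 * Real.pi) × SiteSample L =>
        setSiteAngle (decide (Odd k)) q x.1 x.2)
      (uniformAngle.prod (siteLaw L p)) (siteLaw L p) := by
    cases decide (Odd k)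
    · exact measurePreserving_prod_snd hhalf
    · exact measurePreserving_prod_fst hhalf
  exact measurePreserving_update_infinitePi (fun _ : ℤ => siteLaw L p) uniformAngle (k - 1) _ hsite

open scoped ENNReal in
/-- A bound for the average over two angles is a bound for the full expectation. -/
theorem lintegral_law_le_of_setAngle (k l : ℤ) (i j : Fin L) {p : ℝ} (h0 : 0 ≤ p) (h1 : p ≤ 1)
    {F : Sample L → ℝ≥0∞} (hF : Measurable F) {C : ℝ≥0∞}
    (h : ∀ ω, ∫⁻ θ, ∫⁻ η, F (setAngle k i θ (setAngle l j η ω)) ∂uniformAngle ∂uniformAngle ≤ C) :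
    ∫⁻ ω, F ω ∂(law L p) ≤ C := by
  have := isProbabilityMeasure_law L h0 h1
  have hk := measurePreserving_setAngle (L := L) k i h0 h1
  have hl := measurePreserving_setAngle (L := L) l j h0 h1
  calc ∫⁻ ω, F ω ∂(law L p)
      = ∫⁻ θ, ∫⁻ ω, F (setAngle k i θ ω) ∂(law L p) ∂uniformAngle := by
        rw [← hk.lintegral_comp hF]
        exact lintegral_prod _ (hF.comp hk.measurable).aemeasurable
    _ = ∫⁻ θ, ∫⁻ ω, ∫⁻ η, F (setAngle k i θ (setAngle l j η ω)) ∂uniformAngle ∂(law L p)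
          ∂uniformAngle := by
        refine lintegral_congr fun θ => ?_
        have hm : Measurable fun ω => F (setAngle k i θ ω) :=
          (hF.comp hk.measurable).comp measurable_prodMk_left
        rw [← hl.lintegral_comp hm]
        exact lintegral_prod_symm _ (hm.comp hl.measurable).aemeasurable
    _ = ∫⁻ ω, ∫⁻ θ, ∫⁻ η, F (setAngle k i θ (setAngle l j η ω)) ∂uniformAngle ∂uniformAngle
          ∂(law L p) := by
        rw [lintegral_lintegral_swap]
        refine Measurable.aemeasurable ?_
        refine Measurable.lintegral_prod_right
          (f := fun (x : Set.Icc (0 : ℝ) (2 * Real.pi) × Sample L)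
            (η : Set.Icc (0 : ℝ) (2 * Real.pi)) =>
            F (setAngle k i x.1 (setAngle l j η x.2))) ?_
        have hm2 : Measurable fun q : (Set.Icc (0 : ℝ) (2 * Real.pi) × Sample L) ×
            Set.Icc (0 : ℝ) (2 * Real.pi) => (q.1.1, setAngle l j q.2 q.1.2) :=
          Measurable.prodMk (by fun_prop)
            (hl.measurable.comp (measurable_snd.prodMk (by fun_prop)))
        exact (hF.comp hk.measurable).comp hm2
    _ ≤ ∫⁻ _, C ∂(law L p) := lintegral_mono h
    _ = C := by rw [lintegral_const, measure_univ, mul_one]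

end Resampling

/-! ### How the operator depends on a single angle. -/

section AngleChange

variable {L : ℕ} {I : Set ℤ}

theorem Uph_congr {ω ω' : Sample L} {n : ℤ} (h : ω' n = ω n) : Uph ω' n = Uph ω n := by
  simp only [Uph, h]

theorem Vph_congr {ω ω' : Sample L} {n : ℤ} (h : ω' n = ω n) : Vph ω' n = Vph ω n := by
  simp only [Vph, h]

theorem even_sub_one_sub {k r : ℤ} (h : ¬ Even (k - r)) : Even (k - 1 - r) := by grind

open Classical in
-- $V^{(k-1)}$ is the left factor of the whole second row of $S^{(k-1)}$, so a change of it acts on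
-- the output at $k$ alone.
theorem layer_apply_of_left (α : Matrix (Fin L) (Fin L) ℂ) (bl br : UL L) {ω ω' : Sample L} {r : ℤ}
    (k : I) (hk : (k : ℤ) - 1 ∈ I) (hr : ¬ Even ((k : ℤ) - r)) (E : Matrix (Fin L) (Fin L) ℂ)
    (hω : ∀ m, m ≠ (k : ℤ) - 1 → ω' m = ω m) (hU : Uph ω' (k - 1) = Uph ω (k - 1))
    (hV : (Vph ω' (k - 1) : Matrix (Fin L) (Fin L) ℂ) = E * Vph ω (k - 1)) (f : Hil L I) (i : I) :
    layer α bl br I ω' r f i =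
      if i = k then op E (layer α bl br I ω r f i) else layer α bl br I ω r f i := by
  rw [layer_apply, layer_apply]
  have hkI : mate r k ∈ I := by rwa [mate_of_not_even hr]
  split_ifs with h
  · subst h
    have e1 : layerDiag α bl br ω' r i = E * layerDiag α bl br ω r i := by
      simp only [layerDiag, hkI, hr, if_true, if_false, blockD, hU, hV]
      simp [Matrix.mul_assoc]
    have e2 : layerOff α ω' r i = E * layerOff α ω r i := by
      simp only [layerOff, hkI, hr, if_true, if_false, blockC, hV]
      simp [Matrix.mul_assoc]
    rw [e1, e2, op_mul_apply, op_mul_apply, map_add]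
  · have hne : (i : ℤ) - 1 ≠ k - 1 := fun h' => h (Subtype.ext (by linarith))
    have hU' : Uph ω' i = Uph ω i := by
      by_cases hi : (i : ℤ) = k - 1
      · rw [hi, hU]
      · exact Uph_congr (hω _ hi)
    have e1 : layerDiag α bl br ω' r i = layerDiag α bl br ω r i := by
      simp only [layerDiag, blockD, Uph_congr (hω _ hne), Vph_congr (hω _ hne)]
    have e2 : layerOff α ω' r i = layerOff α ω r i := by
      simp only [layerOff, blockB, blockC, hU', Vph_congr (hω _ hne)]
    rw [e1, e2]

open Classical in
-- $U^{(k-1)}$ is the right factor of the whole second column of $S^{(k-1)}$, so a change of it acts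
-- on the input at $k$ alone. That column is met in two rows, $k$ and $k-1$.
theorem layer_apply_of_right (α : Matrix (Fin L) (Fin L) ℂ) (bl br : UL L) {ω ω' : Sample L} {r : ℤ}
    (k : I) (hk : (k : ℤ) - 1 ∈ I) (hr : ¬ Even ((k : ℤ) - r)) (E : Matrix (Fin L) (Fin L) ℂ)
    (hω : ∀ m, m ≠ (k : ℤ) - 1 → ω' m = ω m) (hV : Vph ω' (k - 1) = Vph ω (k - 1))
    (hU : (Uph ω' (k - 1) : Matrix (Fin L) (Fin L) ℂ) = Uph ω (k - 1) * E) (f g : Hil L I)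
    (hg : ∀ i, g i = if i = k then op E (f i) else f i) :
    layer α bl br I ω' r f = layer α bl br I ω r g := by
  ext1
  funext i
  rw [layer_apply, layer_apply]
  have hkI : mate r k ∈ I := by rwa [mate_of_not_even hr]
  by_cases h : i = k
  · subst h
    have hm : mateIn r i ≠ i := by
      rw [mateIn_of_mem hkI, Ne, Subtype.ext_iff]
      simp only [mate_of_not_even hr]
      linarith
    have e1 : layerDiag α bl br ω' r i = layerDiag α bl br ω r i * E := by
      simp only [layerDiag, hkI, hr, if_true, if_false, blockD, hU, hV]
      simp [Matrix.mul_assoc]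
    have e2 : layerOff α ω' r i = layerOff α ω r i := by
      simp only [layerOff, hkI, hr, if_true, if_false, blockC, hV]
    rw [e1, e2, op_mul_apply, hg, hg, if_pos rfl, if_neg hm]
  · have hne : (i : ℤ) - 1 ≠ k - 1 := fun h' => h (Subtype.ext (by linarith))
    have e1 : layerDiag α bl br ω' r i = layerDiag α bl br ω r i := by
      simp only [layerDiag, blockD, Uph_congr (hω _ hne), Vph_congr (hω _ hne)]
    rw [e1, hg, if_neg h]
    by_cases hi : (i : ℤ) = k - 1
    · have hr' : Even ((i : ℤ) - r) := by rw [hi]; exact even_sub_one_sub hr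
      have hiI : mate r i ∈ I := by rw [mate_of_even hr', hi]; simp
      have hm : mateIn r i = k := by
        rw [mateIn_of_mem hiI, Subtype.ext_iff]
        simp only [mate_of_even hr']
        linarith
      have e2 : layerOff α ω' r i = layerOff α ω r i * E := by
        simp only [layerOff, hiI, hr', if_true, blockB]
        rw [hi, hU, Matrix.mul_assoc]
      rw [e2, op_mul_apply, hg, if_pos hm]
    · have e2 : layerOff α ω' r i = layerOff α ω r i := by
        simp only [layerOff, blockB, blockC, Uph_congr (hω _ hi), Vph_congr (hω _ hne)]
      have hm : mateIn r i ≠ k := by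
        intro hm
        have : i = mateIn r k := by rw [← hm, mateIn_involutive]
        rw [mateIn_of_mem hkI, Subtype.ext_iff] at this
        exact hi (by rw [this]; exact mate_of_not_even hr)
      rw [e2, hg, if_neg hm]

/-- The matrix $S^{(k-1)}$ belongs to the layer of the other parity. -/
theorem layer_congr_of_even (α : Matrix (Fin L) (Fin L) ℂ) (bl br : UL L) {ω ω' : Sample L} {r k : ℤ}
    (hr : Even (k - r)) (hω : ∀ m, m ≠ k - 1 → ω' m = ω m) :
    layer α bl br I ω' r = layer α bl br I ω r := by
  ext1 f
  ext1
  funext i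
  rw [layer_apply, layer_apply]
  by_cases h : Even ((i : ℤ) - r)
  · have hne : (i : ℤ) ≠ k - 1 := by grind
    have e1 : layerDiag α bl br ω' r i = layerDiag α bl br ω r i := by
      simp only [layerDiag, h, if_true]
    have e2 : layerOff α ω' r i = layerOff α ω r i := by
      simp only [layerOff, h, if_true, blockB, Uph_congr (hω _ hne)]
    rw [e1, e2]
  · have hne : (i : ℤ) - 1 ≠ k - 1 := by grind
    have e1 : layerDiag α bl br ω' r i = layerDiag α bl br ω r i := by
      simp only [layerDiag, blockD, Uph_congr (hω _ hne), Vph_congr (hω _ hne)]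
    have e2 : layerOff α ω' r i = layerOff α ω r i := by
      simp only [layerOff, h, if_false, blockC, Vph_congr (hω _ hne)]
    rw [e1, e2]

/-- The random reflection attached to a half sample. -/
noncomputable def reflection (h : HalfSample L) : UL L := h.1 * signU h.2.1 * h.1⁻¹

/-- The unitary whose columns diagonalize the phase acting on the site `k`. -/
noncomputable def frame (ω : Sample L) (k : ℤ) : UL L :=
  if Odd k then reflection (ω (k - 1)).1 else (reflection (ω (k - 1)).2)⁻¹

open Classical in
/-- A column of `frame`, placed at the site `k`. -/
noncomputable def frameVec (ω : Sample L) (k : I) (p : Fin L) : Hil L I :=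
  lp.single 2 k (op (frame ω k : Matrix (Fin L) (Fin L) ℂ) (EuclideanSpace.single p (1 : ℂ)))

/-- The frame is built from the reflections, which contain no angle. The two vectors therefore stay
fixed while the angles are averaged. -/
theorem frame_setAngle (ω : Sample L) (k l : ℤ) (p : Fin L) (θ : Set.Icc (0 : ℝ) (2 * Real.pi)) :
    frame (setAngle l p θ ω) k = frame ω k := by
  by_cases h : k - 1 = l - 1
  · have : k = l := by linarith
    subst this
    by_cases ho : Odd k <;>
      simp [frame, setAngle, setSiteAngle, ho, reflection, setHalfAngle]
  · simp [frame, setAngle, Function.update_of_ne h]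

theorem frameVec_setAngle (ω : Sample L) (k : I) (l : ℤ) (p q : Fin L)
    (θ : Set.Icc (0 : ℝ) (2 * Real.pi)) :
    frameVec (setAngle l p θ ω) k q = frameVec ω k q := by
  rw [frameVec, frame_setAngle, frameVec]

theorem setAngle_comm {k l : ℤ} (h : k ≠ l) (p q : Fin L) (θ η : Set.Icc (0 : ℝ) (2 * Real.pi))
    (ω : Sample L) : setAngle k p θ (setAngle l q η ω) = setAngle l q η (setAngle k p θ ω) := by
  have h1 : k - 1 ≠ l - 1 := fun h' => h (by linarith)
  simp only [setAngle]
  rw [Function.update_of_ne h1, Function.update_of_ne h1.symm, Function.update_comm h1]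

theorem coe_phaseU (θ : Fin L → Set.Icc (0 : ℝ) (2 * Real.pi)) :
    (phaseU θ : Matrix (Fin L) (Fin L) ℂ) =
      Matrix.diagonal fun i => Complex.exp (((θ i : ℝ) : ℂ) * Complex.I) := rfl

/-- The angle zero. -/
noncomputable def zeroAngle : Set.Icc (0 : ℝ) (2 * Real.pi) :=
  ⟨0, le_refl _, by positivity⟩

theorem phaseU_update (θ : Fin L → Set.Icc (0 : ℝ) (2 * Real.pi)) (p : Fin L)
    (t : Set.Icc (0 : ℝ) (2 * Real.pi)) :
    (phaseU (Function.update θ p t) : Matrix (Fin L) (Fin L) ℂ) =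
      Matrix.diagonal (Function.update 1 p (Complex.exp (((t : ℝ) : ℂ) * Complex.I))) *
        phaseU (Function.update θ p zeroAngle) := by
  rw [coe_phaseU, coe_phaseU, Matrix.diagonal_mul_diagonal]
  congr 1
  funext i
  by_cases hi : i = p
  · subst hi; simp [zeroAngle]
  · simp [hi]

theorem op_unitary_inner (F : UL L) (v w : Fib L) :
    inner ℂ (op (F : Matrix (Fin L) (Fin L) ℂ) v) w =
      inner ℂ v (op (F : Matrix (Fin L) (Fin L) ℂ).conjTranspose w) := by
  rw [op_conjTranspose, ContinuousLinearMap.adjoint_inner_right]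

theorem op_conj_diagonal_apply (F : UL L) (p : Fin L) (u : ℂ) (v : Fib L) :
    op ((F : Matrix (Fin L) (Fin L) ℂ) * Matrix.diagonal (Function.update 1 p u) *
      (F : Matrix (Fin L) (Fin L) ℂ).conjTranspose) v =
      linePhase (op (F : Matrix (Fin L) (Fin L) ℂ) (EuclideanSpace.single p (1 : ℂ))) u v := by
  rw [op_mul_apply, op_mul_apply, linePhase_apply, op_unitary_inner]
  have h : ∀ w : Fib L, op (Matrix.diagonal (Function.update 1 p u)) w =
      w + ((u - 1) * inner ℂ (EuclideanSpace.single p (1 : ℂ)) w) • EuclideanSpace.single p (1 : ℂ) := by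
    intro w
    ext i
    have : (op (Matrix.diagonal (Function.update 1 p u)) w) i
        = (Matrix.diagonal (Function.update 1 p u)).mulVec w.ofLp i := rfl
    rw [this, Matrix.mulVec_diagonal]
    by_cases hi : i = p
    · subst hi; simp [EuclideanSpace.inner_single_left]; ring
    · simp [hi]
  rw [h, map_add, map_smul, ← op_mul_apply, unitary_mul_conjTranspose, op_one_apply]

open Classical in
theorem linePhase_single_apply (k : I) (ξ : Fib L) (u : ℂ) (f : Hil L I) (i : I) :
    linePhase (lp.single 2 k ξ : Hil L I) u f i =
      if i = k then linePhase ξ u (f i) else f i := by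
  rw [linePhase_apply, lp.inner_single_left]
  change f i + ((u - 1) * inner ℂ ξ (f k)) • (lp.single 2 k ξ : Hil L I) i = _
  split_ifs with h
  · subst h
    rw [linePhase_apply, lp.single_apply_self]
  · rw [lp.single_apply_ne _ _ _ h, smul_zero, add_zero]

/-- With $F$ the frame, $V=Fe^{i\theta}=(Fe^{i\theta}F^*)F$ for odd $k$ and
$U=e^{i\Theta}F^*=F^*(Fe^{i\Theta}F^*)$ for even $k$. One angle thus contributes a phase on the line
of one column of $F$. The angle zero is a reference value that makes the remaining operator
independent of $\theta$. -/
theorem layer_setAngle (α : Matrix (Fin L) (Fin L) ℂ) (bl br : UL L) {r : ℤ}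
    (k : I) (hk : (k : ℤ) - 1 ∈ I) (hr : ¬ Even ((k : ℤ) - r)) (p : Fin L)
    (θ : Set.Icc (0 : ℝ) (2 * Real.pi)) (ω : Sample L) (f : Hil L I) :
    layer α bl br I (setAngle k p θ ω) r f =
      linePhase (frameVec ω k p)
        (if Odd (k : ℤ) then Complex.exp (((θ : ℝ) : ℂ) * Complex.I) else 1)
        (layer α bl br I (setAngle k p zeroAngle ω) r (linePhase (frameVec ω k p)
          (if Odd (k : ℤ) then 1 else Complex.exp (((θ : ℝ) : ℂ) * Complex.I)) f)) := by
  have hω : ∀ m, m ≠ (k : ℤ) - 1 → setAngle k p θ ω m = setAngle k p zeroAngle ω m := by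
    intro m hm
    simp [setAngle, Function.update_of_ne hm]
  by_cases ho : Odd (k : ℤ)
  · simp only [ho, if_true, linePhase_one]
    ext1
    funext i
    have hfr : frame ω k = reflection (ω (k - 1)).1 := by simp [frame, ho]
    rw [layer_apply_of_left α bl br k hk hr ((frame ω k : Matrix (Fin L) (Fin L) ℂ)
      * Matrix.diagonal (Function.update 1 p (Complex.exp (((θ : ℝ) : ℂ) * Complex.I)))
      * (frame ω k : Matrix (Fin L) (Fin L) ℂ).conjTranspose) hω ?_ ?_ f i, op_conj_diagonal_apply, frameVec,
      linePhase_single_apply]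
    · simp [Uph, setAngle, setSiteAngle, ho]
    · have e : ∀ t, (Vph (setAngle k p t ω) (k - 1) : Matrix (Fin L) (Fin L) ℂ) =
          (frame ω k : Matrix (Fin L) (Fin L) ℂ) * phaseU (Function.update (ω (k - 1)).1.2.2 p t) := by
        intro t
        rw [hfr]
        simp [Vph, setAngle, setSiteAngle, ho, setHalfAngle, reflection]
      rw [e, e, phaseU_update]
      simp only [Matrix.mul_assoc, unitary_conjTranspose_mul_mul]
  · simp only [ho, if_false, linePhase_one]
    have hfr : frame ω k = (reflection (ω (k - 1)).2)⁻¹ := by simp [frame, ho]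
    refine layer_apply_of_right α bl br k hk hr ((frame ω k : Matrix (Fin L) (Fin L) ℂ)
      * Matrix.diagonal (Function.update 1 p (Complex.exp (((θ : ℝ) : ℂ) * Complex.I)))
      * (frame ω k : Matrix (Fin L) (Fin L) ℂ).conjTranspose) hω ?_ ?_ _ _ fun i => ?_
    · simp [Vph, setAngle, setSiteAngle, ho]
    · have e : ∀ t, (Uph (setAngle k p t ω) (k - 1) : Matrix (Fin L) (Fin L) ℂ) =
          phaseU (Function.update (ω (k - 1)).2.2.2 p t) *
            (frame ω k : Matrix (Fin L) (Fin L) ℂ).conjTranspose := by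
        intro t
        have : (frame ω k : Matrix (Fin L) (Fin L) ℂ).conjTranspose
            = (reflection (ω (k - 1)).2 : Matrix (Fin L) (Fin L) ℂ) := by
          rw [hfr]
          exact Matrix.conjTranspose_conjTranspose _
        rw [this]
        simp [Uph, setAngle, setSiteAngle, ho, setHalfAngle, reflection, Matrix.mul_assoc]
      rw [e, e, phaseU_update, coe_phaseU, Matrix.diagonal_mul_diagonal]
      simp only [Matrix.mul_assoc, unitary_conjTranspose_mul_mul]
      rw [← Matrix.mul_assoc (Matrix.diagonal _) (Matrix.diagonal _), Matrix.diagonal_mul_diagonal]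
      congr 2
      funext i
      exact mul_comm _ _
    · rw [op_conj_diagonal_apply, frameVec, linePhase_single_apply]

/-- The parity rule in `setAngle` puts the phase on the outer side of $\mathbb V\mathbb W$: the left
of the even layer for odd $k$, the right of the odd layer for even $k$. No layer separates it from
the resolvent. -/
theorem zipper_setAngle (α : Matrix (Fin L) (Fin L) ℂ) (bl br : UL L) {a b : WithBot (WithTop ℤ)}
    (k : sites a b) (hk : (k : ℤ) - 1 ∈ sites a b) (p : Fin L)
    (θ : Set.Icc (0 : ℝ) (2 * Real.pi)) (ω : Sample L) (f : Hil L (sites a b)) :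
    zipper α bl br a b (setAngle k p θ ω) f =
      linePhase (frameVec ω k p)
        (if Odd (k : ℤ) then Complex.exp (((θ : ℝ) : ℂ) * Complex.I) else 1)
        (zipper α bl br a b (setAngle k p zeroAngle ω) (linePhase (frameVec ω k p)
          (if Odd (k : ℤ) then 1 else Complex.exp (((θ : ℝ) : ℂ) * Complex.I)) f)) := by
  have hω : ∀ m, m ≠ (k : ℤ) - 1 → setAngle k p θ ω m = setAngle k p zeroAngle ω m := by
    intro m hm
    simp [setAngle, Function.update_of_ne hm]
  simp only [zipper, ContinuousLinearMap.comp_apply]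
  by_cases ho : Odd (k : ℤ)
  · rw [layer_setAngle α bl br k hk (by simpa using ho),
      layer_congr_of_even α bl br (k := k) (by grind) hω]
    simp only [ho, if_true, linePhase_one]
  · rw [layer_setAngle α bl br k hk (r := 1) (by grind),
      layer_congr_of_even α bl br (k := k) (r := 0) (by grind) hω]
    simp only [ho, if_false, linePhase_one]

end AngleChange

/-! ### Equations satisfied by the rows and columns of the Green kernel. -/

section Resolvent

variable {L : ℕ} {α : Matrix (Fin L) (Fin L) ℂ} {bl br : UL L} {a b : WithBot (WithTop ℤ)}
  {ω : Sample L} {z : ℂ}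

theorem zipper_resolventOp (hα : ‖op α‖ < 1) (hz : ‖z‖ ≠ 1) (f : Hil L (sites a b)) :
    zipper α bl br a b ω (resolventOp α bl br a b ω z f) - z • resolventOp α bl br a b ω z f = f := by
  have h := Ring.mul_inverse_cancel _ (isUnit_zipper_sub hα bl br a b ω hz)
  exact congrArg (fun T : Hil L (sites a b) →L[ℂ] Hil L (sites a b) => T f) h

theorem adjoint_zipper_adjoint_resolventOp (hα : ‖op α‖ < 1) (hz : ‖z‖ ≠ 1)
    (f : Hil L (sites a b)) :
    star (zipper α bl br a b ω) (star (resolventOp α bl br a b ω z) f)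
      - star z • star (resolventOp α bl br a b ω z) f = f := by
  have h := congrArg star (Ring.inverse_mul_cancel _ (isUnit_zipper_sub hα bl br a b ω hz))
  rw [star_mul, star_sub, star_smul, star_one] at h
  have hid : star (ContinuousLinearMap.id ℂ (Hil L (sites a b))) = 1 := star_one _
  rw [hid] at h
  exact congrArg (fun T : Hil L (sites a b) →L[ℂ] Hil L (sites a b) => T f) h

theorem inner_basisVec {I : Set ℤ} (k : I) (p : Fin L) (f : Hil L I) :
    inner ℂ (basisVec k p) f = f k p := by
  rw [basisVec, lp.inner_single_left, EuclideanSpace.inner_single_left]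
  simp

theorem norm_basisVec {I : Set ℤ} (k : I) (p : Fin L) : ‖(basisVec k p : Hil L I)‖ = 1 := by
  rw [basisVec, lp.norm_single (by norm_num)]
  simp

theorem green_apply (k l : sites a b) (p q : Fin L) :
    green α bl br a b ω z k l p q = (resolventOp α bl br a b ω z (basisVec l q)) k p :=
  inner_basisVec _ _ _

/-- Reads a row of the kernel from the adjoint resolvent; used for columns at the boundary and for
measurability inside the disc. -/
theorem green_apply_eq_star (k l : sites a b) (p q : Fin L) :
    green α bl br a b ω z k l p q =
      star ((star (resolventOp α bl br a b ω z) (basisVec k p)) l q) := by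
  rw [← inner_basisVec, green, Matrix.of_apply, ContinuousLinearMap.star_eq_adjoint,
    ContinuousLinearMap.adjoint_inner_right]
  exact (inner_conj_symm _ _).symm

theorem norm_zipper_apply (hα : ‖op α‖ < 1) (f : Hil L (sites a b)) :
    ‖zipper α bl br a b ω f‖ = ‖f‖ :=
  Unitary.norm_map (⟨_, zipper_mem_unitary hα bl br a b ω⟩ :
    unitary (Hil L (sites a b) →L[ℂ] Hil L (sites a b))) f

theorem zipper_star_zipper (hα : ‖op α‖ < 1) (f : Hil L (sites a b)) :
    zipper α bl br a b ω (star (zipper α bl br a b ω) f) = f :=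
  congrArg (fun T : Hil L (sites a b) →L[ℂ] Hil L (sites a b) => T f)
    (Unitary.mul_star_self_of_mem (zipper_mem_unitary hα bl br a b ω))

end Resolvent

/-! ### Measurability of the Green kernel in the random parameters. -/

section Measurability

variable {L : ℕ} {α : Matrix (Fin L) (Fin L) ℂ}

/-- Coordinatewise measurability of a random vector. -/
def CoordMeasurable {I : Set ℤ} (F : Sample L → Hil L I) : Prop :=
  ∀ i j, Measurable fun ω => (F ω i) j

/-- Entrywise measurability of a random matrix. -/
def EntryMeasurable (A : Sample L → Matrix (Fin L) (Fin L) ℂ) : Prop :=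
  ∀ i j, Measurable fun ω => A ω i j

theorem EntryMeasurable.mul {A B : Sample L → Matrix (Fin L) (Fin L) ℂ} (hA : EntryMeasurable A)
    (hB : EntryMeasurable B) : EntryMeasurable fun ω => A ω * B ω := by
  intro i j
  simp only [Matrix.mul_apply]
  exact Finset.measurable_fun_sum _ fun q _ => (hA i q).mul (hB q j)

theorem EntryMeasurable.const (A : Matrix (Fin L) (Fin L) ℂ) :
    EntryMeasurable fun _ : Sample L => A := fun _ _ => measurable_const

theorem EntryMeasurable.conjTranspose {A : Sample L → Matrix (Fin L) (Fin L) ℂ}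
    (hA : EntryMeasurable A) : EntryMeasurable fun ω => (A ω).conjTranspose := by
  intro i j
  simp only [Matrix.conjTranspose_apply]
  exact continuous_star.measurable.comp (hA j i)

theorem EntryMeasurable.diagonal {c : Sample L → Fin L → ℂ} (hc : ∀ i, Measurable fun ω => c ω i) :
    EntryMeasurable fun ω => Matrix.diagonal (c ω) := by
  intro i j
  by_cases h : i = j
  · subst h; simpa using hc i
  · simp [h]

theorem entryMeasurable_coe {u : Sample L → UL L} (hu : Measurable u) :
    EntryMeasurable fun ω => (u ω : Matrix (Fin L) (Fin L) ℂ) := by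
  intro i j
  have : Continuous fun v : UL L => (v : Matrix (Fin L) (Fin L) ℂ) i j :=
    (continuous_apply j).comp ((continuous_apply i).comp continuous_subtype_val)
  exact this.measurable.comp hu

theorem entryMeasurable_signU {d : Sample L → Fin L → ℤˣ} (hd : Measurable d) :
    EntryMeasurable fun ω => (signU (d ω) : Matrix (Fin L) (Fin L) ℂ) := by
  refine EntryMeasurable.diagonal fun i => ?_
  have : Measurable fun x : ℤˣ => ((x : ℤ) : ℂ) :=
    (Measurable.of_discrete (f := fun n : ℤ => (n : ℂ))).comp (comap_measurable Units.val)
  exact this.comp ((measurable_pi_apply i).comp hd)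

theorem entryMeasurable_phaseU {θ : Sample L → Fin L → Set.Icc (0 : ℝ) (2 * Real.pi)}
    (hθ : Measurable θ) :
    EntryMeasurable fun ω => (phaseU (θ ω) : Matrix (Fin L) (Fin L) ℂ) := by
  refine EntryMeasurable.diagonal fun i => ?_
  have : Measurable fun x : Set.Icc (0 : ℝ) (2 * Real.pi) =>
      Complex.exp (((x : ℝ) : ℂ) * Complex.I) := by fun_prop
  exact this.comp ((measurable_pi_apply i).comp hθ)

theorem entryMeasurable_reflection {h : Sample L → HalfSample L} (hh : Measurable h) :
    EntryMeasurable fun ω => (reflection (h ω) : Matrix (Fin L) (Fin L) ℂ) :=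
  ((entryMeasurable_coe hh.fst).mul (entryMeasurable_signU hh.snd.fst)).mul
    (entryMeasurable_coe hh.fst).conjTranspose

theorem entryMeasurable_Uph (n : ℤ) :
    EntryMeasurable fun ω : Sample L => (Uph ω n : Matrix (Fin L) (Fin L) ℂ) := by
  have h : Measurable fun ω : Sample L => (ω n).2 := (measurable_pi_apply n).snd
  exact (((entryMeasurable_phaseU h.snd.snd).mul (entryMeasurable_coe h.fst)).mul
    (entryMeasurable_signU h.snd.fst)).mul (entryMeasurable_coe h.fst).conjTranspose

theorem entryMeasurable_Vph (n : ℤ) :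
    EntryMeasurable fun ω : Sample L => (Vph ω n : Matrix (Fin L) (Fin L) ℂ) := by
  have h : Measurable fun ω : Sample L => (ω n).1 := (measurable_pi_apply n).fst
  exact (entryMeasurable_reflection h).mul (entryMeasurable_phaseU h.snd.snd)

theorem entryMeasurable_frame (k : ℤ) :
    EntryMeasurable fun ω : Sample L => (frame ω k : Matrix (Fin L) (Fin L) ℂ) := by
  unfold frame
  split_ifs
  · exact entryMeasurable_reflection (measurable_pi_apply (k - 1)).fst
  · exact (entryMeasurable_reflection (measurable_pi_apply (k - 1)).snd).conjTranspose

theorem entryMeasurable_blockD (α : Matrix (Fin L) (Fin L) ℂ) (n : ℤ) :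
    EntryMeasurable fun ω : Sample L => blockD α ω n := by
  intro i j
  exact ((((entryMeasurable_Vph n).mul (EntryMeasurable.const _)).mul
    (entryMeasurable_Uph n)) i j).neg

theorem entryMeasurable_layerDiag (α : Matrix (Fin L) (Fin L) ℂ) (bl br : UL L) (r : ℤ)
    {I : Set ℤ} (i : I) : EntryMeasurable fun ω : Sample L => layerDiag α bl br ω r i := by
  unfold layerDiag
  split_ifs
  · exact EntryMeasurable.const _
  · exact entryMeasurable_blockD α _
  · exact EntryMeasurable.const _
  · exact EntryMeasurable.const _

theorem entryMeasurable_layerOff (α : Matrix (Fin L) (Fin L) ℂ) (r : ℤ)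
    {I : Set ℤ} (i : I) : EntryMeasurable fun ω : Sample L => layerOff α ω r i := by
  unfold layerOff
  split_ifs
  · exact (EntryMeasurable.const _).mul (entryMeasurable_Uph _)
  · exact (entryMeasurable_Vph _).mul (EntryMeasurable.const _)
  · exact EntryMeasurable.const _

variable {I : Set ℤ}

theorem op_apply_coord (A : Matrix (Fin L) (Fin L) ℂ) (v : Fib L) (j : Fin L) :
    op A v j = ∑ q, A j q * v q := rfl

theorem CoordMeasurable.layer {F : Sample L → Hil L I} (hF : CoordMeasurable F)
    (α : Matrix (Fin L) (Fin L) ℂ) (bl br : UL L) (r : ℤ) :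
    CoordMeasurable fun ω => layer α bl br I ω r (F ω) := by
  intro i j
  have h : ∀ (A : Sample L → Matrix (Fin L) (Fin L) ℂ) (m : I), EntryMeasurable A →
      Measurable fun ω => (op (A ω) (F ω m)) j := fun A m hA => by
    simp only [op_apply_coord]
    exact Finset.measurable_fun_sum _ fun q _ => (hA j q).mul (hF m q)
  simp only [layer_apply]
  exact (h _ _ (entryMeasurable_layerDiag α bl br r i)).add (h _ _ (entryMeasurable_layerOff α r i))

theorem CoordMeasurable.of_tendsto {F : ℕ → Sample L → Hil L I} {G : Sample L → Hil L I}
    (hF : ∀ n, CoordMeasurable (F n))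
    (h : ∀ ω, Filter.Tendsto (fun n => F n ω) Filter.atTop (nhds (G ω))) :
    CoordMeasurable G := by
  intro i j
  refine measurable_of_tendsto_metrizable (fun n => hF n i j) ?_
  rw [tendsto_pi_nhds]
  intro ω
  have h1 := ((innerSL ℂ (basisVec i j : Hil L I)).continuous.tendsto _).comp (h ω)
  simp only [Function.comp_def, innerSL_apply_apply, inner_basisVec] at h1
  exact h1

/-- The fixed point of a random affine contraction is coordinatewise measurable. -/
theorem CoordMeasurable.of_fixedPoint {G : Sample L → Hil L I} (T : Sample L → Hil L I → Hil L I)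
    (hT : ∀ F : Sample L → Hil L I, CoordMeasurable F → CoordMeasurable fun ω => T ω (F ω))
    (hG : ∀ ω, T ω (G ω) = G ω) {c : ℝ} (hc0 : 0 ≤ c) (hc : c < 1)
    (hTc : ∀ ω f g, ‖T ω f - T ω g‖ ≤ c * ‖f - g‖) : CoordMeasurable G := by
  refine CoordMeasurable.of_tendsto (F := fun n ω => (T ω)^[n] 0) (fun n => ?_) fun ω => ?_
  · induction n with
    | zero => intro i j; exact measurable_const
    | succ n ih =>
      simp only [Function.iterate_succ_apply']
      exact hT _ ih
  · rw [tendsto_iff_norm_sub_tendsto_zero]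
    have hb : ∀ n, ‖(T ω)^[n] 0 - G ω‖ ≤ c ^ n * ‖G ω‖ := by
      intro n
      induction n with
      | zero => simp
      | succ n ih =>
        rw [Function.iterate_succ_apply']
        conv_lhs => rw [← hG ω]
        calc _ ≤ c * ‖(T ω)^[n] 0 - G ω‖ := hTc _ _ _
          _ ≤ c * (c ^ n * ‖G ω‖) := by gcongr
          _ = _ := by ring
    refine squeeze_zero (fun _ => norm_nonneg _) hb ?_
    simpa using (tendsto_pow_atTop_nhds_zero_of_lt_one hc0 hc).mul_const ‖G ω‖

theorem CoordMeasurable.affine {F G : Sample L → Hil L I} (hF : CoordMeasurable F)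
    (hG : CoordMeasurable G) (c d : ℂ) : CoordMeasurable fun ω => c • F ω + d • G ω := by
  intro i j
  exact ((hF i j).const_mul c).add ((hG i j).const_mul d)

theorem CoordMeasurable.zipper {a b : WithBot (WithTop ℤ)} {F : Sample L → Hil L (sites a b)}
    (hF : CoordMeasurable F) (α : Matrix (Fin L) (Fin L) ℂ) (bl br : UL L) :
    CoordMeasurable fun ω => zipper α bl br a b ω (F ω) :=
  (hF.layer α bl br 1).layer α bl br 0

theorem entryMeasurable_green (hα : ‖op α‖ < 1) (bl br : UL L) (a b : WithBot (WithTop ℤ)) {z : ℂ}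
    (hz : ‖z‖ ≠ 1) (k l : sites a b) : EntryMeasurable fun ω => green α bl br a b ω z k l := by
  have hconst : ∀ f : Hil L (sites a b), CoordMeasurable fun _ : Sample L => f :=
    fun f i j => measurable_const
  intro p q
  rcases lt_or_gt_of_ne hz with hlt | hgt
  -- Inside the disc the adjoint equation is multiplied by $\mathbb U$, giving $\varphi=\bar
  -- z\,\mathbb U\varphi+\mathbb Ue_k$: a contraction of ratio $|z|$ in which only $\mathbb U$
  -- occurs, not its adjoint.
  · simp only [green_apply_eq_star]
    refine continuous_star.measurable.comp ?_
    refine CoordMeasurable.of_fixedPoint (c := ‖z‖) (G := fun ω =>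
      star (resolventOp α bl br a b ω z) (basisVec k p)) (fun ω f =>
      star z • zipper α bl br a b ω f + (1 : ℂ) • zipper α bl br a b ω (basisVec k p))
      (fun F hF => ?_) (fun ω => ?_) (norm_nonneg z) hlt (fun ω f g => ?_) l q
    · exact (hF.zipper α bl br).affine ((hconst _).zipper α bl br) _ _
    · have h := congrArg (zipper α bl br a b ω)
        (adjoint_zipper_adjoint_resolventOp (bl := bl) (br := br) (ω := ω) hα hz (basisVec k p))
      rw [map_sub, map_smul, zipper_star_zipper hα] at h
      rw [one_smul, ← h]
      abel
    · rw [add_sub_add_right_eq_sub, ← smul_sub, ← map_sub, norm_smul, norm_star,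
        norm_zipper_apply hα]
  · simp only [green_apply]
    have hz0 : z ≠ 0 := by rintro rfl; simp at hgt; linarith
    -- Outside the disc the resolvent equation itself is a fixed-point equation, $\psi=z^{-1}\mathbb
    -- U\psi-z^{-1}e_l$, of ratio $|z|^{-1}$.
    refine CoordMeasurable.of_fixedPoint (c := ‖z‖⁻¹) (G := fun ω =>
      resolventOp α bl br a b ω z (basisVec l q)) (fun ω f =>
      z⁻¹ • zipper α bl br a b ω f + (-z⁻¹) • basisVec l q)
      (fun F hF => ?_) (fun ω => ?_) (by positivity) (inv_lt_one_of_one_lt₀ hgt)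
      (fun ω f g => ?_) k p
    · exact (hF.zipper α bl br).affine (hconst _) _ _
    · have h := zipper_resolventOp (bl := bl) (br := br) (ω := ω) hα hz (basisVec l q)
      rw [sub_eq_iff_eq_add] at h
      rw [h, smul_add, smul_smul, inv_mul_cancel₀ hz0]
      module
    · rw [add_sub_add_right_eq_sub, ← smul_sub, ← map_sub, norm_smul, norm_inv,
        norm_zipper_apply hα]

end Measurability

/-! ### Fractional moments between two sites that carry a phase. -/

section Interior

open scoped ENNReal

variable {L : ℕ} {α : Matrix (Fin L) (Fin L) ℂ} {I : Set ℤ}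

theorem norm_frameVec (ω : Sample L) (k : I) (p : Fin L) : ‖frameVec ω k p‖ = 1 := by
  rw [frameVec, lp.norm_single (by norm_num)]
  have := Unitary.norm_map (⟨op (frame ω k : Matrix (Fin L) (Fin L) ℂ),
    Unitary.map_mem (Matrix.toEuclideanCLM (n := Fin L) (𝕜 := ℂ)) (frame ω k).2⟩ :
    unitary (Fib L →L[ℂ] Fib L)) (EuclideanSpace.single p (1 : ℂ))
  exact this.trans (by simp)

theorem inner_frameVec_of_ne (ω : Sample L) {k l : I} (h : k ≠ l) (p q : Fin L) :
    inner ℂ (frameVec ω k p) (frameVec ω l q) = (0 : ℂ) := by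
  rw [frameVec, lp.inner_single_left, frameVec, lp.single_apply_ne _ _ _ h, inner_zero_right]

theorem frameVec_eq_sum (ω : Sample L) (k : I) (p : Fin L) :
    frameVec ω k p = ∑ i, (frame ω k : Matrix (Fin L) (Fin L) ℂ) i p • basisVec k i := by
  have h : op (frame ω k : Matrix (Fin L) (Fin L) ℂ) (EuclideanSpace.single p (1 : ℂ)) =
      ∑ i, (frame ω k : Matrix (Fin L) (Fin L) ℂ) i p • EuclideanSpace.single i (1 : ℂ) := by
    ext j
    rw [op_apply_coord]
    simp [Finset.sum_apply, Pi.single_apply]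
  rw [frameVec, h, ← lp.lsingle_apply (𝕜 := ℂ), map_sum]
  refine Finset.sum_congr rfl fun i _ => ?_
  rw [map_smul]
  rfl

theorem conjTranspose_frame_mul_green_mul_frame (bl br : UL L) {a b : WithBot (WithTop ℤ)}
    (ω : Sample L) (z : ℂ) (k l : sites a b) (p q : Fin L) :
    ((frame ω k : Matrix (Fin L) (Fin L) ℂ).conjTranspose * green α bl br a b ω z k l *
      (frame ω l : Matrix (Fin L) (Fin L) ℂ)) p q =
      inner ℂ (frameVec ω k p) (resolventOp α bl br a b ω z (frameVec ω l q)) := by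
  rw [frameVec_eq_sum, frameVec_eq_sum, map_sum, inner_sum]
  rw [Matrix.mul_apply]
  refine Finset.sum_congr rfl fun j _ => ?_
  rw [map_smul, inner_smul_right, sum_inner, Matrix.mul_apply, mul_comm]
  congr 1
  refine Finset.sum_congr rfl fun i _ => ?_
  rw [inner_smul_left]
  rfl

theorem rpow_sum_le_sum_rpow {ι : Type*} (t : Finset ι) (f : ι → ℝ≥0∞) {s : ℝ} (h0 : 0 < s)
    (h1 : s ≤ 1) : (∑ i ∈ t, f i) ^ s ≤ ∑ i ∈ t, f i ^ s := by
  classical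
  induction t using Finset.induction_on with
  | empty => simp [h0]
  | insert i t hi ih =>
    rw [Finset.sum_insert hi, Finset.sum_insert hi]
    exact (ENNReal.rpow_add_le_add_rpow _ _ h0.le h1).trans (by gcongr)

theorem enorm_unitary_apply_le (u : UL L) (i j : Fin L) :
    ‖(u : Matrix (Fin L) (Fin L) ℂ) i j‖ₑ ≤ 1 := by
  rw [← ofReal_norm, ENNReal.ofReal_le_one]
  exact entry_norm_bound_of_unitary u.2 i j

/-- Fractional moments of the Green kernel between two sites which carry a random phase. -/
theorem lintegral_green_le {s : ℝ} (hs0 : 0 < s) (hs1 : s ≤ 1) {C : ℝ≥0∞} (hC1 : 1 ≤ C)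
    (hC : ∀ c : ℂ, ∫⁻ θ, ‖c + Complex.exp ((θ : ℝ) * Complex.I)‖ₑ ^ (-s) ∂uniformAngle ≤ C)
    {p : ℝ} (hp0 : 0 ≤ p) (hp1 : p ≤ 1) (hα : ‖op α‖ < 1) (bl br : UL L)
    {a b : WithBot (WithTop ℤ)} {z : ℂ} (hz0 : z ≠ 0) (hz : ‖z‖ ≠ 1) {k l : sites a b}
    (hkl : k ≠ l) (hk : (k : ℤ) - 1 ∈ sites a b) (hl : (l : ℤ) - 1 ∈ sites a b) (i j : Fin L) :
    ∫⁻ ω, ‖green α bl br a b ω z k l i j‖ₑ ^ s ∂(law L p) ≤ ∑ _i : Fin L, ∑ _j : Fin L, C * C := by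
  -- The kernel in the frame bases. Unitary matrices have entries of modulus at most 1 and $t\mapsto
  -- t^s$ is subadditive, so returning to the canonical bases costs only a sum of $L^2$ terms.
  set g : Sample L → Matrix (Fin L) (Fin L) ℂ := fun ω =>
    (frame ω k : Matrix (Fin L) (Fin L) ℂ).conjTranspose * green α bl br a b ω z k l *
      (frame ω l : Matrix (Fin L) (Fin L) ℂ) with hg
  have hgm : EntryMeasurable g :=
    ((entryMeasurable_frame k).conjTranspose.mul (entryMeasurable_green hα bl br a b hz k l)).mul
      (entryMeasurable_frame l)
  have hbound : ∀ ω, ‖green α bl br a b ω z k l i j‖ₑ ^ s ≤ ∑ m, ∑ n, ‖g ω m n‖ₑ ^ s := by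
    intro ω
    have e : green α bl br a b ω z k l = (frame ω k : Matrix (Fin L) (Fin L) ℂ) * (g ω *
        (frame ω l : Matrix (Fin L) (Fin L) ℂ).conjTranspose) := by
      simp only [hg, Matrix.mul_assoc, unitary_mul_conjTranspose, Matrix.mul_one]
      rw [unitary_mul_conjTranspose_mul]
    have h1 : ‖green α bl br a b ω z k l i j‖ₑ ≤ ∑ m, ∑ n, ‖g ω m n‖ₑ := by
      rw [e, Matrix.mul_apply]
      refine (enorm_sum_le _ _).trans (Finset.sum_le_sum fun m _ => ?_)
      rw [enorm_mul, Matrix.mul_apply]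
      refine (mul_le_of_le_one_left' (enorm_unitary_apply_le _ _ _)).trans ?_
      refine (enorm_sum_le _ _).trans (Finset.sum_le_sum fun n _ => ?_)
      rw [enorm_mul]
      exact mul_le_of_le_one_right' (enorm_unitary_apply_le (frame ω l)⁻¹ n j)
    calc _ ≤ (∑ m, ∑ n, ‖g ω m n‖ₑ) ^ s := ENNReal.rpow_le_rpow h1 hs0.le
      _ ≤ ∑ m, (∑ n, ‖g ω m n‖ₑ) ^ s := rpow_sum_le_sum_rpow _ _ hs0 hs1
      _ ≤ _ := Finset.sum_le_sum fun m _ => rpow_sum_le_sum_rpow _ _ hs0 hs1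
  have hmeas : ∀ m n, Measurable fun ω => ‖g ω m n‖ₑ ^ s := fun m n => (hgm m n).enorm.pow_const s
  calc _ ≤ ∫⁻ ω, ∑ m, ∑ n, ‖g ω m n‖ₑ ^ s ∂(law L p) := lintegral_mono hbound
    _ = ∑ m, ∑ n, ∫⁻ ω, ‖g ω m n‖ₑ ^ s ∂(law L p) := by
        rw [lintegral_finsetSum _ fun m _ => Finset.measurable_fun_sum _ fun n _ => hmeas m n]
        refine Finset.sum_congr rfl fun m _ => ?_
        rw [lintegral_finsetSum _ fun n _ => hmeas m n]
    _ ≤ _ := by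
        refine Finset.sum_le_sum fun m _ => Finset.sum_le_sum fun n _ => ?_
        refine lintegral_law_le_of_setAngle k l m n hp0 hp1 (hmeas m n) fun ω => ?_
        have hne : (k : ℤ) ≠ l := fun h => hkl (Subtype.ext h)
        have hgi : ∀ θ η, g (setAngle k m θ (setAngle l n η ω)) m n =
            inner ℂ (frameVec ω k m) (resolventOp α bl br a b (setAngle k m θ (setAngle l n η ω)) z
              (frameVec ω l n)) := by
          intro θ η
          rw [hg]
          simp only [conjTranspose_frame_mul_green_mul_frame, frameVec_setAngle]
        simp_rw [hgi]
        refine lintegral_resolvent_linePhase_le hs0 hC1 hC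
          (W := zipper α bl br a b (setAngle l n zeroAngle (setAngle k m zeroAngle ω)))
          (zipper_mem_unitary hα bl br a b _) (norm_frameVec ω k m) (norm_frameVec ω l n)
          (inner_frameVec_of_ne ω hkl m n) hz0 hz _ fun θ η => ?_
        set ψ := resolventOp α bl br a b (setAngle k m θ (setAngle l n η ω)) z (frameVec ω l n)
        have hψ := zipper_resolventOp (bl := bl) (br := br) (a := a) (b := b)
          (ω := setAngle k m θ (setAngle l n η ω)) hα hz (frameVec ω l n)
        -- Both phases are extracted in turn; what stays inside is the operator with the two angles
        -- set to zero, which does not depend on $\theta$ and $\eta$.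
        rw [zipper_setAngle α bl br k hk, setAngle_comm hne, zipper_setAngle α bl br l hl,
          frameVec_setAngle, frameVec_setAngle] at hψ
        have h1 : ∀ t : ℝ, ‖(if Odd (k : ℤ) then 1 else Complex.exp ((t : ℂ) * Complex.I))‖ = 1 := by
          intro t; split_ifs <;> simp [Complex.norm_exp_ofReal_mul_I]
        have h2 : ∀ t : ℝ, ‖(if Odd (l : ℤ) then 1 else Complex.exp ((t : ℂ) * Complex.I))‖ = 1 := by
          intro t; split_ifs <;> simp [Complex.norm_exp_ofReal_mul_I]
        obtain ⟨φ, hφ, hφ'⟩ := exists_linePhase_left (norm_frameVec ω k m) (norm_frameVec ω l n)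
          (inner_frameVec_of_ne ω hkl m n) (h1 θ) (h2 η) hψ
        refine ⟨φ, ?_, hφ'⟩
        have e1 : ∀ (P : Prop) [Decidable P] (u : ℂ), (if P then u else 1) * (if P then 1 else u) = u := by
          intro P _ u; split_ifs <;> simp
        rw [e1, e1] at hφ
        exact hφ

end Interior

/-! ### Sites without a phase, and spectral parameters away from the unit circle. -/

section Boundary

variable {L : ℕ} {α : Matrix (Fin L) (Fin L) ℂ} {I : Set ℤ}

theorem norm_op_unitary_apply (u : UL L) (v : Fib L) :
    ‖op (u : Matrix (Fin L) (Fin L) ℂ) v‖ = ‖v‖ :=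
  Unitary.norm_map (⟨op (u : Matrix (Fin L) (Fin L) ℂ),
    Unitary.map_mem (Matrix.toEuclideanCLM (n := Fin L) (𝕜 := ℂ)) u.2⟩ :
    unitary (Fib L →L[ℂ] Fib L)) v

/-- At a site whose left neighbour is missing, a generalized eigenvector with spectral parameter
close to the unit circle is controlled by its value at the right neighbour. -/
theorem norm_apply_le_of_boundary (hα : ‖op α‖ < 1) (bl br : UL L) (ω : Sample L) (k k' : I)
    (hk : (k : ℤ) - 1 ∉ I) (hk' : (k' : ℤ) = k + 1) {w : ℂ} (hw1 : (1 + ‖op α‖) / 2 < ‖w‖)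
    (hw2 : ‖w‖ * ((1 + ‖op α‖) / 2) < 1) (ψ : Hil L I)
    (hψ : layer α bl br I ω 1 ψ k =
      w • ContinuousLinearMap.adjoint (layer α bl br I ω 0) ψ k) :
    ‖ψ k‖ ≤ 4 * (‖op (rho α)‖ + ‖op (rhoT α)‖) / (1 - ‖op α‖) * ‖ψ k'‖ := by
  have hA := norm_nonneg (op α)
  have hρ := norm_nonneg (op (rho α))
  have hρT := norm_nonneg (op (rhoT α))
  have hk1 : (k : ℤ) + 1 ∈ I := hk' ▸ k'.2
  suffices h : (1 - ‖op α‖) / 2 * ‖ψ k‖ ≤ 2 * (‖op (rho α)‖ + ‖op (rhoT α)‖) * ‖ψ k'‖ by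
    rw [div_mul_eq_mul_div, le_div_iff₀ (by linarith)]
    linarith
  have hw3 : ‖w‖ ≤ 2 := by nlinarith [norm_nonneg w]
  have hn := norm_nonneg (ψ k)
  have hn' := norm_nonneg (ψ k')
  rw [layer_apply, adjoint_layer_apply] at hψ
  -- At the left endpoint exactly one layer is cut, and its block there is the unitary `bl`; the
  -- other layer has diagonal block $\alpha$ and couples $k$ to $k+1$. The unitary term dominates
  -- the $\alpha$ term by at least $\frac{1-\|\alpha\|}2\|\psi(k)\|$: through $1-|w|\|\alpha\|$ if
  -- the odd layer is cut, through $|w|-\|\alpha\|$ if the even one is.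
  by_cases he : Even (k : ℤ)
  · have hm1 : mate 1 (k : ℤ) ∉ I := by rwa [mate_of_not_even (by grind)]
    have hm0e : mate 0 (k : ℤ) = k + 1 := mate_of_even (by simpa using he)
    have hm0 : mate 0 (k : ℤ) ∈ I := by rwa [hm0e]
    have hmk : mateIn 0 k = k' := by
      rw [mateIn_of_mem hm0]; exact Subtype.ext (hm0e.trans hk'.symm)
    have hd1 : layerDiag α bl br ω 1 k = bl := by
      have : ¬ Even ((k : ℤ) - 1) := by grind
      simp only [layerDiag, hm1, this, if_false]
    rcases layer_blocks_of_mem α bl br ω hm0 with ⟨-, h1, h2, h3, h4⟩ | ⟨h, -⟩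
    · rw [hd1, layerOff_of_notMem hm1, op_zero_apply, add_zero, h1, h4, hmk] at hψ
      have e1 := congrArg norm hψ
      rw [norm_op_unitary_apply, norm_smul] at e1
      have e2 : ‖op α.conjTranspose (ψ k) + op (blockC α ω k).conjTranspose (ψ k')‖
          ≤ ‖op α‖ * ‖ψ k‖ + ‖op (rhoT α)‖ * ‖ψ k'‖ := by
        refine (norm_add_le _ _).trans (add_le_add ?_ ?_)
        · exact ContinuousLinearMap.le_of_opNorm_le _ (norm_op_conjTranspose α).le _
        · refine ContinuousLinearMap.le_of_opNorm_le _ ?_ _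
          rw [norm_op_conjTranspose, blockC, norm_op_unitary_mul]
      have e3 := mul_le_mul_of_nonneg_left e2 (norm_nonneg w)
      rw [← e1] at e3
      have e4 : (1 - ‖op α‖) / 2 ≤ 1 - ‖w‖ * ‖op α‖ := by nlinarith [norm_nonneg w]
      have e5 : ‖w‖ * (‖op (rhoT α)‖ * ‖ψ k'‖) ≤ 2 * (‖op (rhoT α)‖ * ‖ψ k'‖) := by gcongr
      nlinarith [mul_le_mul_of_nonneg_right e4 hn, mul_nonneg hρ hn']
    · exact absurd (by simpa using he) h
  · have hm0 : mate 0 (k : ℤ) ∉ I := by rwa [mate_of_not_even (by simpa using he)]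
    have hm1e : mate 1 (k : ℤ) = k + 1 := mate_of_even (by grind)
    have hm1 : mate 1 (k : ℤ) ∈ I := by rwa [hm1e]
    have hmk : mateIn 1 k = k' := by
      rw [mateIn_of_mem hm1]; exact Subtype.ext (hm1e.trans hk'.symm)
    have hd0 : layerDiag α bl br ω 0 k = bl := by
      have : ¬ Even ((k : ℤ) - 0) := by simpa using he
      simp only [layerDiag, hm0, this, if_false]
    rcases layer_blocks_of_mem α bl br ω hm1 with ⟨-, h1, h2, h3, h4⟩ | ⟨h, -⟩
    · rw [hd0, mateIn_of_notMem hm0, layerOff_of_notMem hm0, Matrix.conjTranspose_zero,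
        op_zero_apply, add_zero, h1, h2, hmk] at hψ
      have e1 := congrArg norm hψ
      have e0 : ‖op (bl : Matrix (Fin L) (Fin L) ℂ).conjTranspose (ψ k)‖ = ‖ψ k‖ :=
        norm_op_unitary_apply bl⁻¹ (ψ k)
      rw [norm_smul, e0] at e1
      have e2 : ‖op α (ψ k) + op (blockB α ω k) (ψ k')‖
          ≤ ‖op α‖ * ‖ψ k‖ + ‖op (rho α)‖ * ‖ψ k'‖ := by
        refine (norm_add_le _ _).trans (add_le_add ((op α).le_opNorm _) ?_)
        refine ContinuousLinearMap.le_of_opNorm_le _ ?_ _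
        rw [blockB, norm_op_mul_unitary]
      rw [e1] at e2
      nlinarith [mul_nonneg hρ hn', mul_nonneg hρT hn']
    · exact absurd (by grind) h

theorem basisVec_apply_of_ne {l i : I} (h : i ≠ l) (j : Fin L) :
    (basisVec l j : Hil L I) i = 0 := lp.single_apply_ne _ _ _ h

theorem mateIn_ne {r : ℤ} {k l : I} (h : 1 < |(k : ℤ) - l|) : mateIn r k ≠ l := by
  intro h'
  have h1 : |(k : ℤ) - mateIn r k| ≤ 1 := by
    by_cases hm : mate r k ∈ I
    · rw [mateIn_of_mem hm]
      by_cases he : Even ((k : ℤ) - r)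
      · simp [mate_of_even he]
      · simp [mate_of_not_even he]
    · simp [mateIn_of_notMem hm]
  rw [h'] at h1
  omega

theorem ne_of_one_lt_abs {k l : I} (h : 1 < |(k : ℤ) - l|) : k ≠ l := by
  rintro rfl
  simp at h

theorem norm_fib_le (v : Fib L) : ‖v‖ ≤ ∑ i, ‖v i‖ := by
  have h : v = ∑ i, v i • EuclideanSpace.single i (1 : ℂ) := by
    ext j
    simp [Finset.sum_apply, Pi.single_apply]
  conv_lhs => rw [h]
  refine (norm_sum_le _ _).trans (Finset.sum_le_sum fun i _ => ?_)
  simp [norm_smul]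

variable {bl br : UL L} {a b : WithBot (WithTop ℤ)} {ω : Sample L} {z : ℂ}

/-- The resolvent equation is rewritten as $\mathbb W\psi=z\mathbb V^*\psi+\mathbb V^*e_l$, which is
local. At distance more than 1 from $l$ the source vanishes, leaving the homogeneous equation of
`norm_apply_le_of_boundary`. -/
theorem norm_green_le_of_row (hα : ‖op α‖ < 1) (hz : ‖z‖ ≠ 1) (hz1 : (1 + ‖op α‖) / 2 < ‖z‖)
    (hz2 : ‖z‖ * ((1 + ‖op α‖) / 2) < 1) {k k' l : sites a b} (hk : (k : ℤ) - 1 ∉ sites a b)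
    (hk' : (k' : ℤ) = k + 1) (hkl : 1 < |(k : ℤ) - l|) (i j : Fin L) :
    ‖green α bl br a b ω z k l i j‖ ≤ 4 * (‖op (rho α)‖ + ‖op (rhoT α)‖) / (1 - ‖op α‖) *
      ∑ m, ‖green α bl br a b ω z k' l m j‖ := by
  set ψ := resolventOp α bl br a b ω z (basisVec l j) with hψd
  have hψ : zipper α bl br a b ω ψ - z • ψ = basisVec l j := zipper_resolventOp hα hz _
  simp only [green_apply]
  have hψ2 : layer α bl br (sites a b) ω 1 ψ = z • ContinuousLinearMap.adjoint
      (layer α bl br (sites a b) ω 0) ψ + ContinuousLinearMap.adjoint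
      (layer α bl br (sites a b) ω 0) (basisVec l j) := by
    rw [← map_smul, ← map_add, ← hψ, add_sub_cancel]
    exact (congrArg (fun T : Hil L (sites a b) →L[ℂ] Hil L (sites a b) =>
      T (layer α bl br (sites a b) ω 1 ψ))
      (Unitary.star_mul_self_of_mem (layer_mem_unitary hα bl br (sites a b) ω 0))).symm
  have h0 : ContinuousLinearMap.adjoint (layer α bl br (sites a b) ω 0) (basisVec l j) k = 0 := by
    rw [adjoint_layer_apply, basisVec_apply_of_ne (ne_of_one_lt_abs hkl),
      basisVec_apply_of_ne (mateIn_ne hkl), map_zero, map_zero, add_zero]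
  have hψ3 : layer α bl br (sites a b) ω 1 ψ k = z • ContinuousLinearMap.adjoint
      (layer α bl br (sites a b) ω 0) ψ k := by
    rw [hψ2]
    change z • ContinuousLinearMap.adjoint (layer α bl br (sites a b) ω 0) ψ k +
      ContinuousLinearMap.adjoint (layer α bl br (sites a b) ω 0) (basisVec l j) k = _
    rw [h0, add_zero]
  have hpos : 0 ≤ 4 * (‖op (rho α)‖ + ‖op (rhoT α)‖) / (1 - ‖op α‖) :=
    div_nonneg (by positivity) (by linarith)
  calc ‖ψ k i‖ ≤ ‖ψ k‖ := PiLp.norm_apply_le _ _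
    _ ≤ _ := norm_apply_le_of_boundary hα bl br ω k k' hk hk' hz1 hz2 ψ hψ3
    _ ≤ _ := mul_le_mul_of_nonneg_left (norm_fib_le _) hpos

/-- The adjoint resolvent satisfies $\mathbb V^*\varphi=\bar z\,\mathbb W\varphi+\mathbb We_k$, the
same homogeneous equation at $l$ with $w=\bar z^{-1}$. The window for $|z|$ is symmetric under
inversion, so the boundary estimate still applies. -/
theorem norm_green_le_of_column (hα : ‖op α‖ < 1) (hz : ‖z‖ ≠ 1) (hz1 : (1 + ‖op α‖) / 2 < ‖z‖)
    (hz2 : ‖z‖ * ((1 + ‖op α‖) / 2) < 1) {k l l' : sites a b} (hl : (l : ℤ) - 1 ∉ sites a b)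
    (hl' : (l' : ℤ) = l + 1) (hkl : 1 < |(k : ℤ) - l|) (i j : Fin L) :
    ‖green α bl br a b ω z k l i j‖ ≤ 4 * (‖op (rho α)‖ + ‖op (rhoT α)‖) / (1 - ‖op α‖) *
      ∑ m, ‖green α bl br a b ω z k l' i m‖ := by
  have hlk : 1 < |(l : ℤ) - k| := by rwa [abs_sub_comm]
  have hz0 : 0 < ‖z‖ := by linarith [norm_nonneg (op α)]
  have hz0' : star z ≠ 0 := star_ne_zero.2 (norm_pos_iff.1 hz0)
  set φ := star (resolventOp α bl br a b ω z) (basisVec k i) with hφd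
  have hφ : star (zipper α bl br a b ω) φ - star z • φ = basisVec k i :=
    adjoint_zipper_adjoint_resolventOp hα hz _
  simp only [green_apply_eq_star, norm_star]
  have hφ2 : ContinuousLinearMap.adjoint (layer α bl br (sites a b) ω 0) φ =
      star z • layer α bl br (sites a b) ω 1 φ + layer α bl br (sites a b) ω 1 (basisVec k i) := by
    rw [← map_smul, ← map_add, ← hφ, add_sub_cancel, ContinuousLinearMap.star_eq_adjoint, zipper,
      ContinuousLinearMap.adjoint_comp]
    exact (congrArg (fun T : Hil L (sites a b) →L[ℂ] Hil L (sites a b) =>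
      T (ContinuousLinearMap.adjoint (layer α bl br (sites a b) ω 0) φ))
      (Unitary.mul_star_self_of_mem (layer_mem_unitary hα bl br (sites a b) ω 1))).symm
  have h0 : layer α bl br (sites a b) ω 1 (basisVec k i) l = 0 := by
    rw [layer_apply, basisVec_apply_of_ne (ne_of_one_lt_abs hlk),
      basisVec_apply_of_ne (mateIn_ne hlk), map_zero, map_zero, add_zero]
  have hφ3 : layer α bl br (sites a b) ω 1 φ l = (star z)⁻¹ • ContinuousLinearMap.adjoint
      (layer α bl br (sites a b) ω 0) φ l := by
    rw [hφ2]
    change _ = (star z)⁻¹ • (star z • layer α bl br (sites a b) ω 1 φ l +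
      layer α bl br (sites a b) ω 1 (basisVec k i) l)
    rw [h0, add_zero, smul_smul, inv_mul_cancel₀ hz0', one_smul]
  have hpos : 0 ≤ 4 * (‖op (rho α)‖ + ‖op (rhoT α)‖) / (1 - ‖op α‖) :=
    div_nonneg (by positivity) (by linarith)
  have hw1 : (1 + ‖op α‖) / 2 < ‖(star z)⁻¹‖ := by
    rw [norm_inv, norm_star, lt_inv_comm₀ (by positivity) hz0, ← one_div,
      lt_div_iff₀ (by positivity)]
    exact hz2
  have hw2 : ‖(star z)⁻¹‖ * ((1 + ‖op α‖) / 2) < 1 := by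
    rw [norm_inv, norm_star, inv_mul_lt_iff₀ hz0, mul_one]
    exact hz1
  calc ‖φ l j‖ ≤ ‖φ l‖ := PiLp.norm_apply_le _ _
    _ ≤ _ := norm_apply_le_of_boundary hα bl br ω l l' hl hl' hw1 hw2 φ hφ3
    _ ≤ _ := mul_le_mul_of_nonneg_left (norm_fib_le _) hpos

/-- The bound of the Green kernel away from the unit circle. -/
theorem norm_green_le_of_far (hα : ‖op α‖ < 1) {δ : ℝ} (hδ : 0 < δ) (hz : δ ≤ |‖z‖ - 1|)
    (k l : sites a b) (i j : Fin L) : ‖green α bl br a b ω z k l i j‖ ≤ δ⁻¹ := by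
  have hz' : ‖z‖ ≠ 1 := by
    intro h
    rw [h, sub_self, abs_zero] at hz
    linarith
  set ψ := resolventOp α bl br a b ω z (basisVec l j) with hψd
  have hψ : zipper α bl br a b ω ψ - z • ψ = basisVec l j := zipper_resolventOp hα hz' _
  -- As $\mathbb U$ is isometric, $\|\mathbb U\psi-z\psi\|\ge\big|1-|z|\big|\,\|\psi\|$.
  have h1 : |‖z‖ - 1| * ‖ψ‖ ≤ 1 := by
    have h2 := abs_norm_sub_norm_le (zipper α bl br a b ω ψ) (z • ψ)
    rw [hψ, norm_basisVec, norm_zipper_apply hα, norm_smul] at h2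
    rwa [show ‖ψ‖ - ‖z‖ * ‖ψ‖ = -((‖z‖ - 1) * ‖ψ‖) by ring, abs_neg, abs_mul, abs_norm] at h2
  have h3 : ‖ψ‖ ≤ δ⁻¹ := by
    rw [← one_div, le_div_iff₀ hδ, mul_comm]
    exact (mul_le_mul_of_nonneg_right hz (norm_nonneg _)).trans h1
  rw [green_apply]
  exact (PiLp.norm_apply_le _ _).trans ((lp.norm_apply_le_norm (by norm_num) ψ k).trans h3)

end Boundary

/-! ### Comparison of a subordinate norm with the entries. -/

section SubordinateNorm

variable {L : ℕ}

theorem seminorm_le_sum (N : Seminorm ℂ (Fin L → ℂ)) (x : Fin L → ℂ) :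
    N x ≤ ∑ i, ‖x i‖ * N (Pi.single i 1) := by
  have h : x = ∑ i, x i • (Pi.single i 1 : Fin L → ℂ) := by
    funext j
    simp [Finset.sum_apply, Pi.single_apply]
  conv_lhs => rw [h]
  refine (Finset.le_sum_of_subadditive N (map_zero N).le (map_add_le_add N) _ _).trans ?_
  simp only [map_smul_eq_mul, le_refl]

/-- On a finite-dimensional space every norm dominates the supremum norm. -/
theorem exists_norm_le_seminorm (N : Seminorm ℂ (Fin L → ℂ)) (hN : ∀ x, N x = 0 → x = 0) :
    ∃ c : ℝ, 0 < c ∧ ∀ x, ‖x‖ ≤ c * N x := by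
  have hcont : Continuous N := by
    have hle : ∀ x, N x ≤ (∑ i, N (Pi.single i 1)) * ‖x‖ := by
      intro x
      refine (seminorm_le_sum N x).trans ?_
      rw [Finset.sum_mul]
      refine Finset.sum_le_sum fun i _ => ?_
      rw [mul_comm]
      exact mul_le_mul_of_nonneg_left (norm_le_pi_norm x i) (apply_nonneg _ _)
    refine continuous_iff_continuousAt.2 fun x => ?_
    rw [ContinuousAt, tendsto_iff_norm_sub_tendsto_zero]
    refine squeeze_zero (fun _ => norm_nonneg _)
      (g := fun y => (∑ i, N (Pi.single i 1)) * ‖y - x‖) (fun y => ?_) ?_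
    · exact (abs_sub_map_le_sub N y x).trans (hle _)
    · have : Continuous fun y : Fin L → ℂ => (∑ i, N (Pi.single i 1)) * ‖y - x‖ := by fun_prop
      simpa using this.tendsto x
  -- The unit sphere is empty only for $L=0$; otherwise compactness gives a positive minimum of `N`
  -- on it.
  rcases (Metric.sphere (0 : Fin L → ℂ) 1).eq_empty_or_nonempty with he | hne
  · refine ⟨1, one_pos, fun x => ?_⟩
    by_cases hx : x = 0
    · simp [hx]
    · exfalso
      have : ((‖x‖⁻¹ : ℝ) : ℂ) • x ∈ Metric.sphere (0 : Fin L → ℂ) 1 := by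
        rw [mem_sphere_zero_iff_norm, norm_smul, Complex.norm_real, norm_inv, norm_norm,
          inv_mul_cancel₀ (norm_ne_zero_iff.2 hx)]
      rw [he] at this
      exact this
  · obtain ⟨x₀, hx₀, hmin⟩ := (isCompact_sphere (0 : Fin L → ℂ) 1).exists_isMinOn hne
      hcont.continuousOn
    have hx₀' : ‖x₀‖ = 1 := mem_sphere_zero_iff_norm.1 hx₀
    have hpos : 0 < N x₀ := by
      refine lt_of_le_of_ne (apply_nonneg _ _) fun h => ?_
      rw [hN x₀ h.symm] at hx₀'
      simp at hx₀'
    refine ⟨(N x₀)⁻¹, inv_pos.2 hpos, fun x => ?_⟩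
    by_cases hx : x = 0
    · simp [hx]
    · have hxn : 0 < ‖x‖ := norm_pos_iff.2 hx
      have hmem : ((‖x‖⁻¹ : ℝ) : ℂ) • x ∈ Metric.sphere (0 : Fin L → ℂ) 1 := by
        rw [mem_sphere_zero_iff_norm, norm_smul, Complex.norm_real, norm_inv, norm_norm,
          inv_mul_cancel₀ (norm_ne_zero_iff.2 hx)]
      have h := hmin hmem
      simp only [Set.mem_ofPred_eq] at h
      rw [map_smul_eq_mul, Complex.norm_real, norm_inv, norm_norm, ← div_eq_inv_mul,
        le_div_iff₀ hxn] at h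
      rw [← div_eq_inv_mul, le_div_iff₀ hpos, mul_comm]
      exact h

/-- A constant such that the subordinate norm is bounded by the sum of the moduli of the entries. -/
theorem exists_seminorm_mulVec_le (N : Seminorm ℂ (Fin L → ℂ)) (hN : ∀ x, N x = 0 → x = 0) :
    ∃ M : ℝ, 0 ≤ M ∧ ∀ (A : Matrix (Fin L) (Fin L) ℂ) (x : Fin L → ℂ), N x ≤ 1 →
      N (A.mulVec x) ≤ M * ∑ i, ∑ j, ‖A i j‖ := by
  obtain ⟨c, hc, h⟩ := exists_norm_le_seminorm N hN
  have hS : ∀ i, N (Pi.single i 1) ≤ ∑ i, N (Pi.single i 1) := fun i =>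
    Finset.single_le_sum (f := fun i => N (Pi.single i 1)) (fun i _ => apply_nonneg _ _)
      (Finset.mem_univ i)
  have hS0 : 0 ≤ ∑ i, N (Pi.single i 1) := Finset.sum_nonneg fun i _ => apply_nonneg _ _
  refine ⟨c * ∑ i, N (Pi.single i 1), by positivity, fun A x hx => ?_⟩
  refine (seminorm_le_sum N _).trans ?_
  rw [Finset.mul_sum]
  refine Finset.sum_le_sum fun i _ => ?_
  have h1 : ‖A.mulVec x i‖ ≤ c * ∑ j, ‖A i j‖ := by
    rw [Matrix.mulVec, dotProduct, Finset.mul_sum]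
    refine (norm_sum_le _ _).trans (Finset.sum_le_sum fun j _ => ?_)
    rw [norm_mul, mul_comm]
    refine mul_le_mul_of_nonneg_right ?_ (norm_nonneg _)
    calc ‖x j‖ ≤ ‖x‖ := norm_le_pi_norm x j
      _ ≤ c * N x := h x
      _ ≤ c := mul_le_of_le_one_right hc.le hx
  calc _ ≤ (c * ∑ j, ‖A i j‖) * ∑ i, N (Pi.single i 1) :=
        mul_le_mul h1 (hS i) (apply_nonneg _ _) (by positivity)
    _ = _ := by ring

theorem subordinateNorm_nonneg (N : Seminorm ℂ (Fin L → ℂ)) (A : Matrix (Fin L) (Fin L) ℂ) :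
    0 ≤ subordinateNorm N A :=
  Real.sSup_nonneg (by rintro _ ⟨x, -, rfl⟩; exact apply_nonneg _ _)

variable {N : Seminorm ℂ (Fin L → ℂ)} {M : ℝ}

theorem subordinateNorm_le (hM0 : 0 ≤ M)
    (hM : ∀ (A : Matrix (Fin L) (Fin L) ℂ) (x : Fin L → ℂ), N x ≤ 1 →
      N (A.mulVec x) ≤ M * ∑ i, ∑ j, ‖A i j‖) (A : Matrix (Fin L) (Fin L) ℂ) :
    subordinateNorm N A ≤ M * ∑ i, ∑ j, ‖A i j‖ :=
  Real.sSup_le (by rintro _ ⟨x, hx, rfl⟩; exact hM A x hx) (by positivity)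

theorem subordinateNorm_sub_le (hM0 : 0 ≤ M)
    (hM : ∀ (A : Matrix (Fin L) (Fin L) ℂ) (x : Fin L → ℂ), N x ≤ 1 →
      N (A.mulVec x) ≤ M * ∑ i, ∑ j, ‖A i j‖) (A B : Matrix (Fin L) (Fin L) ℂ) :
    subordinateNorm N A - subordinateNorm N B ≤ M * ∑ i, ∑ j, ‖A i j - B i j‖ := by
  rw [sub_le_iff_le_add]
  refine Real.sSup_le ?_ (add_nonneg (by positivity) (subordinateNorm_nonneg N B))
  rintro _ ⟨x, hx, rfl⟩
  have h1 : N (B.mulVec x) ≤ subordinateNorm N B :=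
    le_csSup ⟨M * ∑ i, ∑ j, ‖B i j‖, by rintro _ ⟨y, hy, rfl⟩; exact hM B y hy⟩ ⟨x, hx, rfl⟩
  have h2 : N ((A - B).mulVec x) ≤ M * ∑ i, ∑ j, ‖A i j - B i j‖ := hM (A - B) x hx
  have h3 : A.mulVec x = (A - B).mulVec x + B.mulVec x := by rw [← Matrix.add_mulVec, sub_add_cancel]
  calc N (A.mulVec x) ≤ N ((A - B).mulVec x) + N (B.mulVec x) := by
        rw [h3]; exact map_add_le_add N _ _
    _ ≤ _ := add_le_add h2 h1

/-- A supremum over an uncountable set need not be measurable by itself; here it is Lipschitz in the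
entries, hence continuous. -/
theorem measurable_subordinateNorm (hN : ∀ x, N x = 0 → x = 0)
    {A : Sample L → Matrix (Fin L) (Fin L) ℂ} (hA : EntryMeasurable A) :
    Measurable fun ω => subordinateNorm N (A ω) := by
  obtain ⟨M, hM0, hM⟩ := exists_seminorm_mulVec_le N hN
  have hcont : Continuous fun A : Fin L → Fin L → ℂ => subordinateNorm N (Matrix.of A) := by
    refine continuous_iff_continuousAt.2 fun B => ?_
    rw [ContinuousAt, tendsto_iff_norm_sub_tendsto_zero]
    refine squeeze_zero (fun _ => norm_nonneg _)
      (g := fun A : Fin L → Fin L → ℂ => M * ∑ i, ∑ j, ‖A i j - B i j‖) (fun A => ?_) ?_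
    · rw [Real.norm_eq_abs, abs_le']
      refine ⟨subordinateNorm_sub_le hM0 hM _ _, ?_⟩
      rw [neg_sub]
      refine (subordinateNorm_sub_le hM0 hM _ _).trans (le_of_eq ?_)
      simp only [Matrix.of_apply, norm_sub_rev]
    · have : Continuous fun A : Fin L → Fin L → ℂ => M * ∑ i, ∑ j, ‖A i j - B i j‖ := by fun_prop
      simpa using this.tendsto B
  exact hcont.measurable.comp
    (measurable_pi_lambda _ fun i => measurable_pi_lambda _ fun j => hA i j)

end SubordinateNorm

/-! ### Assembly of the interior, boundary and far estimates. -/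

section FractionalMoments

open scoped ENNReal

variable {L : ℕ} {α : Matrix (Fin L) (Fin L) ℂ}

theorem mem_sites_of_le {a b : WithBot (WithTop ℤ)} {m n i : ℤ} (hm : m ∈ sites a b)
    (hn : n ∈ sites a b) (h1 : m ≤ i) (h2 : i ≤ n) : i ∈ sites a b :=
  ⟨hm.1.trans (by exact_mod_cast h1), le_trans (by exact_mod_cast h2) hn.2⟩

/-- If the left neighbour of a site `k` is missing and the interval contains a site far from `k`, then
the right neighbour of `k` is in the interval. -/
theorem succ_mem_sites {a b : WithBot (WithTop ℤ)} {k l : sites a b} (h : 1 < |(k : ℤ) - l|)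
    (hk : (k : ℤ) - 1 ∉ sites a b) : (k : ℤ) + 1 ∈ sites a b := by
  rcases le_total (k : ℤ) l with hle | hle
  · rw [abs_of_nonpos (by linarith)] at h
    exact mem_sites_of_le k.2 l.2 (by linarith) (by linarith)
  · rw [abs_of_nonneg (by linarith)] at h
    exact absurd (mem_sites_of_le l.2 k.2 (by linarith) (by linarith)) hk

theorem enorm_le_of_norm_le_mul_sum {ι : Type*} [Fintype ι] {K : ℝ} {w : ℂ} {f : ι → ℂ}
    (hK : 0 ≤ K) (h : ‖w‖ ≤ K * ∑ m, ‖f m‖) : ‖w‖ₑ ≤ ENNReal.ofReal K * ∑ m, ‖f m‖ₑ := by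
  have h1 := ENNReal.ofReal_le_ofReal h
  rw [ENNReal.ofReal_mul hK, ENNReal.ofReal_sum_of_nonneg fun _ _ => norm_nonneg _] at h1
  simpa only [ofReal_norm] using h1

/-- Near the unit circle, a matrix element of the Green kernel between distant sites is controlled by
matrix elements between sites which carry a random phase. -/
theorem exists_enorm_green_le (hα : ‖op α‖ < 1) {z : ℂ} (hz : ‖z‖ ≠ 1)
    (hz1 : (1 + ‖op α‖) / 2 < ‖z‖) (hz2 : ‖z‖ * ((1 + ‖op α‖) / 2) < 1)
    {a b : WithBot (WithTop ℤ)} {k l : sites a b} (hkl : 4 < |(k : ℤ) - l|) :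
    ∃ k' l' : sites a b, k' ≠ l' ∧ (k' : ℤ) - 1 ∈ sites a b ∧ (l' : ℤ) - 1 ∈ sites a b ∧
      ∀ (bl br : UL L) (ω : Sample L) (i j : Fin L), ‖green α bl br a b ω z k l i j‖ₑ ≤
        ENNReal.ofReal (1 + 4 * (‖op (rho α)‖ + ‖op (rhoT α)‖) / (1 - ‖op α‖)) *
        ∑ m, ENNReal.ofReal (1 + 4 * (‖op (rho α)‖ + ‖op (rhoT α)‖) / (1 - ‖op α‖)) *
        ∑ n, ‖green α bl br a b ω z k' l' m n‖ₑ := by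
  set K := 4 * (‖op (rho α)‖ + ‖op (rhoT α)‖) / (1 - ‖op α‖) with hK
  have hK0 : 0 ≤ K := div_nonneg (by positivity) (by linarith)
  have hone : ∀ (f : Fin L → ℂ) (m : Fin L), ‖f m‖ ≤ (1 + K) * ∑ m, ‖f m‖ := by
    intro f m
    have h1 : ‖f m‖ ≤ ∑ m, ‖f m‖ :=
      Finset.single_le_sum (f := fun m => ‖f m‖) (fun i _ => norm_nonneg _) (Finset.mem_univ m)
    have h2 : 0 ≤ ∑ m, ‖f m‖ := (norm_nonneg _).trans h1
    nlinarith
  have hmono : ∀ f : Fin L → ℂ, K * ∑ m, ‖f m‖ ≤ (1 + K) * ∑ m, ‖f m‖ := by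
    intro f
    gcongr
    linarith
  -- A site with a phase is kept; a left endpoint is replaced by its right neighbour. The factor
  -- $1+K$ covers both cases. Row and then column move by at most 1 each, so the distance stays
  -- above 2 and the two new sites differ.
  have hrow : ∃ k' : sites a b, |(k' : ℤ) - k| ≤ 1 ∧ (k' : ℤ) - 1 ∈ sites a b ∧
      ∀ (bl br : UL L) (ω : Sample L) (i j : Fin L), ‖green α bl br a b ω z k l i j‖ₑ ≤
        ENNReal.ofReal (1 + K) * ∑ m, ‖green α bl br a b ω z k' l m j‖ₑ := by
    by_cases hk : (k : ℤ) - 1 ∈ sites a b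
    · exact ⟨k, by simp, hk, fun bl br ω i j => enorm_le_of_norm_le_mul_sum (by linarith)
        (hone (fun m => green α bl br a b ω z k l m j) i)⟩
    · refine ⟨⟨k + 1, succ_mem_sites (l := l) (by linarith) hk⟩, by simp, by simp,
        fun bl br ω i j => enorm_le_of_norm_le_mul_sum (by linarith) ?_⟩
      exact (norm_green_le_of_row hα hz hz1 hz2 hk rfl (by linarith) i j).trans (hmono _)
  obtain ⟨k', hk', hk'm, hk'b⟩ := hrow
  have hk'l : 3 < |(k' : ℤ) - l| := by
    rw [lt_abs] at hkl ⊢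
    rw [abs_le] at hk'
    omega
  have hcol : ∃ l' : sites a b, |(l' : ℤ) - l| ≤ 1 ∧ (l' : ℤ) - 1 ∈ sites a b ∧
      ∀ (bl br : UL L) (ω : Sample L) (i j : Fin L), ‖green α bl br a b ω z k' l i j‖ₑ ≤
        ENNReal.ofReal (1 + K) * ∑ m, ‖green α bl br a b ω z k' l' i m‖ₑ := by
    by_cases hl : (l : ℤ) - 1 ∈ sites a b
    · exact ⟨l, by simp, hl, fun bl br ω i j => enorm_le_of_norm_le_mul_sum (by linarith)
        (hone (fun m => green α bl br a b ω z k' l i m) j)⟩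
    · refine ⟨⟨l + 1, succ_mem_sites (l := k') (by rw [abs_sub_comm]; linarith) hl⟩, by simp,
        by simp, fun bl br ω i j => enorm_le_of_norm_le_mul_sum (by linarith) ?_⟩
      exact (norm_green_le_of_column hα hz hz1 hz2 hl rfl (by linarith) i j).trans (hmono _)
  obtain ⟨l', hl', hl'm, hl'b⟩ := hcol
  refine ⟨k', l', ?_, hk'm, hl'm, fun bl br ω i j => ?_⟩
  · rintro rfl
    linarith
  · refine (hk'b bl br ω i j).trans ?_
    gcongr with m
    exact hl'b bl br ω m j

/-- A uniform bound for the fractional moments of the entries of the Green kernel. -/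
theorem exists_lintegral_green_le (hα : ‖op α‖ < 1) {p : ℝ} (hp0 : 0 ≤ p) (hp1 : p ≤ 1) {s : ℝ}
    (hs0 : 0 < s) (hs1 : s < 1) :
    ∃ C : ℝ≥0∞, C ≠ ∞ ∧ ∀ (bl br : UL L) (z : ℂ), ‖z‖ ≠ 1 → ∀ (a b : WithBot (WithTop ℤ))
      (k l : sites a b), 4 < |(k : ℤ) - l| → ∀ i j,
      ∫⁻ ω, ‖green α bl br a b ω z k l i j‖ₑ ^ s ∂(law L p) ≤ C := by
  have := isProbabilityMeasure_law L hp0 hp1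
  obtain ⟨C₀, hC₀, hC₁, hC⟩ := exists_lintegral_circle_le hs0 hs1
  have hA := norm_nonneg (op α)
  set r := (1 + ‖op α‖) / 2 with hr
  have hr0 : 0 < r := by rw [hr]; linarith
  have hr1 : r < 1 := by rw [hr]; linarith
  set K := 1 + 4 * (‖op (rho α)‖ + ‖op (rhoT α)‖) / (1 - ‖op α‖) with hK
  set C₂ : ℝ≥0∞ := ∑ _i : Fin L, ∑ _j : Fin L, C₀ * C₀ with hC₂
  have hC₂' : C₂ ≠ ∞ := by
    rw [hC₂]
    simp only [ne_eq, ENNReal.sum_eq_top, not_exists, not_and]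
    intro _ _ _ _
    exact ENNReal.mul_ne_top hC₀ hC₀
  set C₃ : ℝ≥0∞ := ENNReal.ofReal K ^ s * ∑ _m : Fin L, ENNReal.ofReal K ^ s * ∑ _n : Fin L, C₂
    with hC₃
  have hKs : ENNReal.ofReal K ^ s ≠ ∞ := ENNReal.rpow_ne_top_of_nonneg hs0.le ENNReal.ofReal_ne_top
  have hC₃' : C₃ ≠ ∞ := by
    refine ENNReal.mul_ne_top hKs ?_
    simp only [ne_eq, ENNReal.sum_eq_top, not_exists, not_and]
    intro _ _
    refine ENNReal.mul_ne_top hKs ?_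
    simp only [ne_eq, ENNReal.sum_eq_top, not_exists, not_and]
    exact fun _ _ => hC₂'
  refine ⟨ENNReal.ofReal (1 - r)⁻¹ ^ s + C₃, ?_, ?_⟩
  · exact ENNReal.add_ne_top.2
      ⟨ENNReal.rpow_ne_top_of_nonneg hs0.le ENNReal.ofReal_ne_top, hC₃'⟩
  intro bl br z hz a b k l hkl i j
  -- The annulus $r<|z|<1/r$ is where the boundary estimate holds. Its complement, which contains
  -- $z=0$, is at distance at least $1-r$ from the unit circle.
  by_cases hnear : r < ‖z‖ ∧ ‖z‖ * r < 1
  · refine le_trans ?_ le_add_self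
    have hz0 : z ≠ 0 := norm_pos_iff.1 (hr0.trans hnear.1)
    obtain ⟨k', l', hne, hk', hl', h⟩ := exists_enorm_green_le hα hz hnear.1 hnear.2 hkl
    have hm : ∀ m n, Measurable fun ω => ‖green α bl br a b ω z k' l' m n‖ₑ ^ s := fun m n =>
      (entryMeasurable_green hα bl br a b hz k' l' m n).enorm.pow_const s
    calc _ ≤ ∫⁻ ω, ENNReal.ofReal K ^ s * ∑ m, ENNReal.ofReal K ^ s *
          ∑ n, ‖green α bl br a b ω z k' l' m n‖ₑ ^ s ∂(law L p) := by
          refine lintegral_mono fun ω => ?_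
          refine (ENNReal.rpow_le_rpow (h bl br ω i j) hs0.le).trans ?_
          rw [ENNReal.mul_rpow_of_nonneg _ _ hs0.le]
          gcongr
          refine (rpow_sum_le_sum_rpow _ _ hs0 hs1.le).trans (Finset.sum_le_sum fun m _ => ?_)
          rw [ENNReal.mul_rpow_of_nonneg _ _ hs0.le]
          gcongr
          exact rpow_sum_le_sum_rpow _ _ hs0 hs1.le
      _ = ENNReal.ofReal K ^ s * ∑ m, ENNReal.ofReal K ^ s *
          ∑ n, ∫⁻ ω, ‖green α bl br a b ω z k' l' m n‖ₑ ^ s ∂(law L p) := by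
          rw [lintegral_const_mul' _ _ hKs, lintegral_finsetSum _ fun m _ =>
            (Finset.measurable_fun_sum _ fun n _ => hm m n).const_mul _]
          congr 1
          refine Finset.sum_congr rfl fun m _ => ?_
          rw [lintegral_const_mul' _ _ hKs, lintegral_finsetSum _ fun n _ => hm m n]
      _ ≤ C₃ := by
          rw [hC₃]
          gcongr with m _ n _
          exact lintegral_green_le hs0 hs1.le hC₁ hC hp0 hp1 hα bl br hz0 hz hne hk' hl' m n
  · refine le_trans ?_ le_self_add
    have hfar : 1 - r ≤ |‖z‖ - 1| := by
      rw [not_and_or, not_lt, not_lt] at hnear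
      rcases hnear with h | h
      · rw [abs_of_nonpos (by linarith)]; linarith
      · have h1 : 1 ≤ ‖z‖ := by nlinarith [norm_nonneg z]
        rw [abs_of_nonneg (by linarith)]
        nlinarith
    calc _ ≤ ∫⁻ _, ENNReal.ofReal (1 - r)⁻¹ ^ s ∂(law L p) := by
          refine lintegral_mono fun ω => ENNReal.rpow_le_rpow ?_ hs0.le
          rw [← ofReal_norm]
          exact ENNReal.ofReal_le_ofReal (norm_green_le_of_far hα (by linarith) hfar k l i j)
      _ = _ := by rw [lintegral_const, measure_univ, mul_one]

end FractionalMoments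

end ScatteringZipper

theorem mainTheorem5 (L : ℕ) (hL : 1 ≤ L)
    (p : ℝ) (hp0 : 0 < p) (hp1 : p < 1)
    (α : Matrix (Fin L) (Fin L) ℂ) (hα : ‖op α‖ < 1)
    (N : Seminorm ℂ (Fin L → ℂ)) (hN : ∀ x, N x = 0 → x = 0)
    (s : ℝ) (hs0 : 0 < s) (hs1 : s < 1 / 4) :
    ∃ C : ℝ, 0 < C ∧
      ∀ (bl br : UL L) (z : ℂ), ‖z‖ ≠ 1 →
      ∀ a b : WithBot (WithTop ℤ), a < b →
        (∀ ω : Sample L,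
          IsUnit (zipper α bl br a b ω - z • ContinuousLinearMap.id ℂ (Hil L (sites a b)))) ∧
        ∀ k l : sites a b, 4 < |(k : ℤ) - (l : ℤ)| →
          Integrable (fun ω => subordinateNorm N (green α bl br a b ω z k l) ^ s) (law L p) ∧
          ∫ ω, subordinateNorm N (green α bl br a b ω z k l) ^ s ∂(law L p) ≤ C := by
  obtain ⟨C, hC, hgreen⟩ := exists_lintegral_green_le hα hp0.le hp1.le hs0 (by linarith : s < 1)
  obtain ⟨M, hM0, hM⟩ := exists_seminorm_mulVec_le N hN
  set B : ENNReal := ENNReal.ofReal M ^ s * ∑ _i : Fin L, ∑ _j : Fin L, C with hB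
  have hMs : ENNReal.ofReal M ^ s ≠ ⊤ := ENNReal.rpow_ne_top_of_nonneg hs0.le ENNReal.ofReal_ne_top
  have hBtop : B ≠ ⊤ := by
    refine ENNReal.mul_ne_top hMs ?_
    simp only [ne_eq, ENNReal.sum_eq_top, not_exists, not_and]
    exact fun _ _ _ _ => hC
  -- The added 1 only makes the constant strictly positive.
  refine ⟨B.toReal + 1, by positivity, fun bl br z hz a b _ =>
    ⟨fun ω => isUnit_zipper_sub hα bl br a b ω hz, fun k l hkl => ?_⟩⟩
  have hent := entryMeasurable_green hα bl br a b hz k l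
  have hmeas : Measurable fun ω => subordinateNorm N (green α bl br a b ω z k l) ^ s :=
    (measurable_subordinateNorm hN hent).pow_const s
  have hm : ∀ m n, Measurable fun ω => ‖green α bl br a b ω z k l m n‖ₑ ^ s := fun m n =>
    (hent m n).enorm.pow_const s
  have hnonneg : ∀ ω, 0 ≤ subordinateNorm N (green α bl br a b ω z k l) ^ s := fun ω =>
    Real.rpow_nonneg (subordinateNorm_nonneg _ _) _
  have hle : ∫⁻ ω, ENNReal.ofReal (subordinateNorm N (green α bl br a b ω z k l) ^ s) ∂(law L p)
      ≤ B := by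
    calc _ ≤ ∫⁻ ω, ENNReal.ofReal M ^ s *
          ∑ m, ∑ n, ‖green α bl br a b ω z k l m n‖ₑ ^ s ∂(law L p) := by
          refine lintegral_mono fun ω => ?_
          rw [← ENNReal.ofReal_rpow_of_nonneg (subordinateNorm_nonneg _ _) hs0.le]
          have h1 := ENNReal.ofReal_le_ofReal
            (subordinateNorm_le hM0 hM (green α bl br a b ω z k l))
          have h2 : ENNReal.ofReal (∑ m, ∑ n, ‖green α bl br a b ω z k l m n‖)
              = ∑ m, ∑ n, ‖green α bl br a b ω z k l m n‖ₑ := by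
            rw [ENNReal.ofReal_sum_of_nonneg fun m _ => Finset.sum_nonneg fun n _ =>
              norm_nonneg (green α bl br a b ω z k l m n)]
            refine Finset.sum_congr rfl fun m _ => ?_
            rw [ENNReal.ofReal_sum_of_nonneg fun n _ =>
              norm_nonneg (green α bl br a b ω z k l m n)]
            simp only [ofReal_norm]
          rw [ENNReal.ofReal_mul hM0, h2] at h1
          refine (ENNReal.rpow_le_rpow h1 hs0.le).trans ?_
          rw [ENNReal.mul_rpow_of_nonneg _ _ hs0.le]
          gcongr
          exact (rpow_sum_le_sum_rpow _ _ hs0 (by linarith)).trans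
            (Finset.sum_le_sum fun m _ => rpow_sum_le_sum_rpow _ _ hs0 (by linarith))
      _ = ENNReal.ofReal M ^ s *
          ∑ m, ∑ n, ∫⁻ ω, ‖green α bl br a b ω z k l m n‖ₑ ^ s ∂(law L p) := by
          rw [lintegral_const_mul' _ _ hMs, lintegral_finsetSum _ fun m _ =>
            Finset.measurable_fun_sum _ fun n _ => hm m n]
          congr 1
          refine Finset.sum_congr rfl fun m _ => ?_
          rw [lintegral_finsetSum _ fun n _ => hm m n]
      _ ≤ B := by
          rw [hB]
          gcongr with m _ n _
          exact hgreen bl br z hz a b k l hkl m n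
  -- The bound on the lower Lebesgue integral yields integrability as well as the estimate; without
  -- integrability the Bochner integral would be 0 by convention and the inequality would say
  -- nothing.
  refine ⟨⟨hmeas.aestronglyMeasurable, ?_⟩, ?_⟩
  · rw [hasFiniteIntegral_iff_ofReal (Filter.Eventually.of_forall hnonneg)]
    exact lt_of_le_of_lt hle (lt_top_iff_ne_top.2 hBtop)
  · rw [integral_eq_lintegral_of_nonneg_ae (Filter.Eventually.of_forall hnonneg)
      hmeas.aestronglyMeasurable]
    exact (ENNReal.toReal_mono hBtop hle).trans (by linarith)
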